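/- Let $\Gamma=(V,E)$ be a finite graph (loops and parallel edges allowed). The graphical cake of $\Gamma$ is the topological space obtained from $|E|$ copies of $[0,1]$, one for each edge, by identifying endpoints that represent the same vertex. A piece of cake is a finite union of subintervals of edges; its connected pieces are its path components. The part of the cake belonging to a connected component of $\Gamma$ is the union of the edges of that component, and the component is assigned wholly to an agent if the agent's piece contains this part and the other agent's piece is disjoint from it. A division is a pair of pieces $(\alpha,\beta)$ whose union is the cake and whose intersection is finite. The radius of a connected graph is $\min_v\max_u d(v,u)$ over its vertices. Suppose that $\Gamma$ has $s$ connected components and that $r$ is the maximum of their radii. Let $v_A,v_B$ be Borel probability measures on the cake that vanish on every single point, and let $0\le t\le 1$. Then there is a division $(\alpha,\beta)$ of the cake (with $\alpha$ given to agent $A$ and $\beta$ to agent $B$) such that $$v_A(\alpha)=v_B(\alpha)=t,\qquad v_A(\beta)=v_B(\beta)=1-t,$$ the numbers of connected pieces of $\alpha$ and of $\beta$ add up to at most $s+2r+4$, and, moreover, at least one of the following holds: (i) there is a component $C$ such that each of the other $s-1$ components is assigned wholly to one of the two agents, and each agent receives at most $r+2$ connected pieces from $C$; (ii) there are two distinct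 components $C,D$ such that each of the other $s-2$ components is assigned wholly to one of the two agents, and each agent receives at most $r+3$ connected pieces from $C\cup D$. -/

import Mathlib

open MeasureTheory

/-- A graph with vertices `V` and edges `E`, in which loops and parallel edges are allowed. Every
edge `e` has the two endpoints `left e` and `right e`; which one is called left only fixes
a parametrization of the edge by `[0,1]`. -/
structure CakeGraph (V E : Type*) where
  left : E → V
  right : E → V

namespace CakeGraph

variable {V E : Type*} (G : CakeGraph V E)

/-- Two different vertices are adjacent if some edge joins them. Loops and multiplicities of edges
are irrelevant to connected components and to distances. -/
def toSimpleGraph : SimpleGraph V :=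
  SimpleGraph.fromRel fun u v => ∃ e, G.left e = u ∧ G.right e = v

/-- The connected components of the graph. -/
abbrev Component : Type _ := G.toSimpleGraph.ConnectedComponent

/-- The maximum of the radii of the connected components. The radius of a component is the minimum
over its vertices `v` of the maximal distance from `v` to a vertex of the component. -/
noncomputable def maxRadius : ℕ∞ := ⨆ C : G.Component, C.toSimpleGraph.radius

/-- The point at parameter `p.2` of the interval of the edge `p.1` is the vertex `v`. -/
def IsVertexPoint (p : (_ : E) × unitInterval) (v : V) : Prop :=
  (p.2 = 0 ∧ G.left p.1 = v) ∨ (p.2 = 1 ∧ G.right p.1 = v)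

/-- The identification of endpoints of intervals that represent the same vertex. -/
def gluing : Setoid ((_ : E) × unitInterval) where
  r p q := p = q ∨ ∃ v, G.IsVertexPoint p v ∧ G.IsVertexPoint q v
  iseqv := by
    refine ⟨fun p => Or.inl rfl, ?_, ?_⟩
    · rintro p q (h | ⟨v, hp, hq⟩)
      · exact Or.inl h.symm
      · exact Or.inr ⟨v, hq, hp⟩
    · rintro p q z (rfl | ⟨v, hp, hq⟩) (rfl | ⟨w, hq', hz⟩)
      · exact Or.inl rfl
      · exact Or.inr ⟨w, hq', hz⟩
      · exact Or.inr ⟨v, hp, hq⟩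
      · have hvw : v = w := by
          rcases hq with ⟨h0, h⟩ | ⟨h0, h⟩ <;> rcases hq' with ⟨h1, h'⟩ | ⟨h1, h'⟩
          · exact h.symm.trans h'
          · exact absurd (h0.symm.trans h1) zero_ne_one
          · exact absurd (h1.symm.trans h0) zero_ne_one
          · exact h.symm.trans h'
        subst hvw
        exact Or.inr ⟨v, hp, hz⟩

/-- The graphical cake: one interval for every edge, with endpoints identified according to
the graph. -/
def Cake : Type _ := Quotient G.gluing

/-- The quotient topology. -/
instance : TopologicalSpace G.Cake :=
  inferInstanceAs (TopologicalSpace (Quotient G.gluing))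

/-- The Borel σ-algebra. -/
instance : MeasurableSpace G.Cake := borel G.Cake

instance : BorelSpace G.Cake := ⟨rfl⟩

variable {G}

/-- The point at parameter `x` of the edge `e`. -/
def point (e : E) (x : unitInterval) : G.Cake :=
  Quotient.mk G.gluing ⟨e, x⟩

/-- A piece of cake: a finite union of subintervals of edges. -/
def IsPiece (α : Set G.Cake) : Prop :=
  ∃ S : Set (Set G.Cake), S.Finite ∧
    (∀ I ∈ S, ∃ (e : E) (J : Set unitInterval), J.OrdConnected ∧ I = point e '' J) ∧ α = ⋃₀ S

/-- The number of connected pieces of `α`, i.e. of path components of `α` with the topology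
induced from the cake. -/
noncomputable def numPieces (α : Set G.Cake) : ℕ∞ := ENat.card (ZerothHomotopy α)

/-- The part of the cake formed by the edges of a connected component of the graph. -/
def Component.cake (C : G.Component) : Set G.Cake :=
  {p | ∃ (e : E) (x : unitInterval), G.left e ∈ C.supp ∧ p = point e x}

/-- A division of the cake between two agents. -/
structure IsDivision (α β : Set G.Cake) : Prop where
  left : IsPiece α
  right : IsPiece β
  union : α ∪ β = Set.univ
  inter : (α ∩ β).Finite

/-- A division that both agents, with valuations `vA` and `vB`, value as `t` and `1 - t`. -/
structure IsWeightedConsensus (vA vB : Measure G.Cake) (t : ℝ) (α β : Set G.Cake) : Prop where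
  division : IsDivision α β
  leftA : vA.real α = t
  leftB : vB.real α = t
  rightA : vA.real β = 1 - t
  rightB : vB.real β = 1 - t

/-- The component `C` is assigned wholly to one of the two agents. -/
def Component.Whole (C : G.Component) (α β : Set G.Cake) : Prop :=
  (C.cake ⊆ α ∧ Disjoint C.cake β) ∨ (C.cake ⊆ β ∧ Disjoint C.cake α)

end CakeGraph

/-!
A division is obtained by cutting the cake at two points of a suitable circular order of its
points.

*Tours.* In a connected component of radius at most `r`, breadth-first search from a vertex in the
centre gives a spanning tree of height at most `r`. A depth-first tour of this tree runs through all
edges of the component once; an edge outside of the tree is inserted as a dangling path at one of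
its endpoints. An initial portion of the tour is connected (`Tour.joinedTo_trace`). At any time, the
tour is at the end of a branch with at most `r` edges, and what is left to do at each of
the at most `r + 1` vertices of this branch is connected; together with the rest of the current edge
these are at most `r + 2` connected pieces. The same bound holds for the portion of the tour between
two times, and for the union of an initial portion with a later one, since the part at the root is
attached to the initial portion (`Tour.exists_trace_eq_union`).

*Two cuts.* The components are toured one after the other. One agent gets what is visited between
two times `p` and `q`, the other agent gets the rest (`exists_division`). If both times fall into
the same component, the bounds above give (i). If they fall into different components, each agent
gets an initial portion of one of them, which is a single piece, and a final portion of the other,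
which gives (ii). All other components are visited entirely before `p`, between `p` and `q`, or
after `q`. The sum of all these numbers gives the bound on the total number of pieces.

*Consensus.* Let `F` and `H` be the distribution functions of the two measures with respect to the
tour; they are continuous because points have measure zero. It remains to find `p ≤ q` such that
both `F q - F p` and `H q - H p` are equal to `t`, or both are equal to `1 - t`, in which case the
agents swap their shares (`exists_common_interval`). After reparametrization by the mean of the two
measures, `F` becomes `x ↦ x + h x` and `H` becomes `x ↦ x - h x`, with `h` continuous and
`h 0 = h 1`. So what is needed is a horizontal chord of length `t` of `h`, considered as a function
on a circle of length one, and this exists by the intermediate value theorem (`exists_chord`).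
-/

namespace CakeGraph

open Set

/-! ### Counting path components -/

section Pieces

variable {X : Type*} [TopologicalSpace X]

/-- The number of path components of a subset, with the subspace topology. This is `numPieces` for
an arbitrary topological space. -/
noncomputable def pieceCount (S : Set X) : ℕ∞ := ENat.card (ZerothHomotopy S)

theorem pieceCount_empty : pieceCount (∅ : Set X) = 0 := by
  have : IsEmpty (ZerothHomotopy (∅ : Set X)) :=
    ⟨fun z => by
      induction z using ZerothHomotopy.rec with
      | mk x => exact x.2⟩
  exact (ENat.card_eq_zero_iff_empty _).2 this

theorem pieceCount_union_le (S T : Set X) :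
    pieceCount (S ∪ T) ≤ pieceCount S + pieceCount T := by
  let f : ZerothHomotopy S ⊕ ZerothHomotopy T → ZerothHomotopy (S ∪ T : Set X) :=
    Sum.elim
      (ZerothHomotopy.lift (fun x => .mk ⟨x.1, .inl x.2⟩) fun x y h =>
        ZerothHomotopy.sound (h.map (f := fun z : S => (⟨z.1, .inl z.2⟩ : (S ∪ T : Set X)))
          (by fun_prop)))
      (ZerothHomotopy.lift (fun x => .mk ⟨x.1, .inr x.2⟩) fun x y h =>
        ZerothHomotopy.sound (h.map (f := fun z : T => (⟨z.1, .inr z.2⟩ : (S ∪ T : Set X)))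
          (by fun_prop)))
  have hf : Function.Surjective f := by
    intro z
    induction z using ZerothHomotopy.rec with
    | mk x =>
      obtain ⟨x, hx | hx⟩ := x
      · exact ⟨.inl (.mk ⟨x, hx⟩), rfl⟩
      · exact ⟨.inr (.mk ⟨x, hx⟩), rfl⟩
  have h := ENat.card_le_card_of_injective (Function.injective_surjInv hf)
  rwa [ENat.card_sum] at h

theorem pieceCount_biUnion_le {ι : Type*} (s : Finset ι) (S : ι → Set X) :
    pieceCount (⋃ i ∈ s, S i) ≤ ∑ i ∈ s, pieceCount (S i) := by
  classical
  induction s using Finset.induction_on with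
  | empty => simp [pieceCount_empty]
  | insert a s ha ih =>
    rw [Finset.set_biUnion_insert, Finset.sum_insert ha]
    exact (pieceCount_union_le _ _).trans (by gcongr)

/-- Every point of `S` can be joined to `c` inside `S`. The empty set is allowed, so this says that
`S` is empty or path connected and contains `c`. -/
def JoinedTo (c : X) (S : Set X) : Prop := ∀ x ∈ S, JoinedIn S x c

theorem joinedTo_empty (c : X) : JoinedTo c ∅ := fun _ h => h.elim

theorem JoinedTo.pieceCount_le {c : X} {S : Set X} (h : JoinedTo c S) : pieceCount S ≤ 1 := by
  rw [pieceCount, ENat.card_le_one_iff_subsingleton]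
  refine ⟨fun z w => ?_⟩
  induction z using ZerothHomotopy.rec with
  | mk x =>
    induction w using ZerothHomotopy.rec with
    | mk y =>
      exact ZerothHomotopy.sound ((h x x.2).trans (h y y.2).symm).joined_subtype.somePath

theorem JoinedTo.hang {c d : X} {S T : Set X} (hS : JoinedTo c S) (hd : d ∈ S)
    (hT : JoinedTo d T) : JoinedTo c (S ∪ T) := by
  rintro x (hx | hx)
  · exact (hS x hx).mono subset_union_left
  · exact ((hT x hx).mono subset_union_right).trans ((hS d hd).mono subset_union_left)

theorem JoinedTo.union {c : X} {S T : Set X} (hS : JoinedTo c S) (hT : JoinedTo c T) :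
    JoinedTo c (S ∪ T) := by
  rintro x (hx | hx)
  · exact (hS x hx).mono subset_union_left
  · exact (hT x hx).mono subset_union_right

/-- The image of a subinterval under a path is joined to the image of each of its points. -/
theorem joinedTo_image_Icc {f : ℝ → X} (hf : Continuous f) {S : Set ℝ} (hS : S.OrdConnected)
    {x : ℝ} (hx : x ∈ S) : JoinedTo (f x) (f '' S) := by
  rintro _ ⟨y, hy, rfl⟩
  have : IsPathConnected S := hS.convex.isPathConnected ⟨x, hx⟩
  exact (this.joinedIn y hy x hx).map hf

theorem pieceCount_image_le {f : ℝ → X} (hf : Continuous f) {S : Set ℝ} (hS : S.OrdConnected) :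
    pieceCount (f '' S) ≤ 1 := by
  rcases S.eq_empty_or_nonempty with rfl | ⟨x, hx⟩
  · simp [pieceCount_empty]
  · exact (joinedTo_image_Icc hf hS hx).pieceCount_le

end Pieces

/-! ### Depth-first tours -/

section Tours

variable {X ι : Type*} (γ : ι → ℝ → X)

/-- The paths `γ a` for `a` in a list, each of them run through on `[0,1]`, are concatenated to
a (discontinuous) motion, and `trace γ ℓ p q` is the set of positions between the times `p`
and `q`. A position at an integer time is counted for both of the paths that meet there. -/
def trace : List ι → ℝ → ℝ → Set X
  | [], _, _ => ∅
  | a :: ℓ, p, q => γ a '' (Icc 0 1 ∩ Icc p q) ∪ trace ℓ (p - 1) (q - 1)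

variable {γ}

theorem trace_append (ℓ₁ ℓ₂ : List ι) (p q : ℝ) :
    trace γ (ℓ₁ ++ ℓ₂) p q =
      trace γ ℓ₁ p q ∪ trace γ ℓ₂ (p - ℓ₁.length) (q - ℓ₁.length) := by
  induction ℓ₁ generalizing p q with
  | nil => simp [trace]
  | cons a ℓ ih =>
    simp only [List.cons_append, trace, ih, List.length_cons, Nat.cast_add, Nat.cast_one,
      union_assoc, sub_sub, add_comm (1 : ℝ)]

theorem trace_eq_empty_of_neg (ℓ : List ι) {p q : ℝ} (hq : q < 0) : trace γ ℓ p q = ∅ := by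
  induction ℓ generalizing p q with
  | nil => rfl
  | cons a ℓ ih =>
    rw [trace, ih (by linarith), union_empty, image_eq_empty]
    ext x
    simp only [mem_inter_iff, mem_Icc, mem_empty_iff_false, iff_false]
    intro h; linarith [h.1.1, h.2.2]

theorem trace_eq_empty_of_length_lt (ℓ : List ι) {p q : ℝ} (hp : ℓ.length < p) :
    trace γ ℓ p q = ∅ := by
  induction ℓ generalizing p q with
  | nil => rfl
  | cons a ℓ ih =>
    simp only [List.length_cons, Nat.cast_add, Nat.cast_one] at hp
    have h0 : (0 : ℝ) ≤ ℓ.length := Nat.cast_nonneg _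
    rw [trace, ih (by linarith), union_empty, image_eq_empty]
    ext x
    simp only [mem_inter_iff, mem_Icc, mem_empty_iff_false, iff_false]
    intro h; linarith [h.1.2, h.2.1]

theorem trace_union (ℓ : List ι) {p q u : ℝ} (hpq : p ≤ q) (hqu : q ≤ u) :
    trace γ ℓ p q ∪ trace γ ℓ q u = trace γ ℓ p u := by
  induction ℓ generalizing p q u with
  | nil => simp [trace]
  | cons a ℓ ih =>
    rw [trace, trace, trace, union_union_union_comm, ih (by linarith) (by linarith),
      ← image_union, ← inter_union_distrib_left, Icc_union_Icc_eq_Icc hpq hqu]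

theorem trace_full (ℓ : List ι) {p q : ℝ} (hp : p ≤ 0) (hq : ℓ.length ≤ q) :
    trace γ ℓ p q = ⋃ a ∈ ℓ, γ a '' Icc 0 1 := by
  induction ℓ generalizing p q with
  | nil => simp [trace]
  | cons a ℓ ih =>
    simp only [List.length_cons, Nat.cast_add, Nat.cast_one] at hq
    have h0 : (0 : ℝ) ≤ ℓ.length := Nat.cast_nonneg _
    rw [trace, ih (by linarith) (by linarith),
      inter_eq_left.2 (Icc_subset_Icc hp (by linarith))]
    simp

variable [TopologicalSpace X]

variable (γ) in
/-- `Tour γ ℓ c r` says that the list `ℓ` of paths is a depth-first tour, starting at the point `c`,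
of a rooted tree of paths of height at most `r`, to which further dangling paths may be attached.
A dangling path starts at the current point and is not followed any further; a tree path is
followed by a tour `ℓ₁` from its end, of smaller depth, and then the tour `ℓ₂` from `c` goes on. -/
inductive Tour : List ι → X → ℕ → Prop
  | nil (c : X) (r : ℕ) : Tour [] c r
  | dangling {a : ι} {ℓ : List ι} {c : X} {r : ℕ} (ha : γ a 0 = c) (h : Tour ℓ c r) :
      Tour (a :: ℓ) c r
  | tree {a : ι} {ℓ₁ ℓ₂ : List ι} {c : X} {r : ℕ} (ha : γ a 0 = c)
      (h₁ : Tour ℓ₁ (γ a 1) r) (h₂ : Tour ℓ₂ c (r + 1)) : Tour (a :: (ℓ₁ ++ ℓ₂)) c (r + 1)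

/-- An initial portion of a tour is connected: each path starts at a point visited earlier. -/
theorem Tour.joinedTo_trace (hγ : ∀ a, Continuous (γ a)) {ℓ : List ι} {c : X} {r : ℕ}
    (h : Tour γ ℓ c r) {p q : ℝ} (hp : p ≤ 0) : JoinedTo c (trace γ ℓ p q) := by
  induction h generalizing p q with
  | nil c r => exact joinedTo_empty _
  | @dangling a ℓ c r ha h ih =>
    rcases lt_or_ge q 0 with hq | hq
    · rw [trace_eq_empty_of_neg _ hq]; exact joinedTo_empty _
    · have := joinedTo_image_Icc (hγ a) (ordConnected_Icc.inter ordConnected_Icc)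
        (x := 0) ⟨⟨le_rfl, zero_le_one⟩, hp, hq⟩
      rw [ha] at this
      exact this.union (ih (by linarith))
  | @tree a ℓ₁ ℓ₂ c r ha h₁ h₂ ih₁ ih₂ =>
    rcases lt_or_ge q 0 with hq | hq
    · rw [trace_eq_empty_of_neg _ hq]; exact joinedTo_empty _
    · have h0 := joinedTo_image_Icc (hγ a) (ordConnected_Icc.inter ordConnected_Icc)
        (x := 0) ⟨⟨le_rfl, zero_le_one⟩, hp, hq⟩
      rw [ha] at h0
      have hl : (0 : ℝ) ≤ ℓ₁.length := Nat.cast_nonneg _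
      rw [trace, trace_append, ← union_assoc]
      refine JoinedTo.union ?_ (ih₂ (by linarith))
      rcases lt_or_ge q 1 with hq1 | hq1
      · rw [trace_eq_empty_of_neg ℓ₁ (by linarith), union_empty]; exact h0
      · exact h0.hang ⟨1, ⟨⟨zero_le_one, le_rfl⟩, by linarith, hq1⟩, rfl⟩
          (ih₁ (by linarith))

/-- The portion of a tour between two times. When it starts, the tour is at the end of a branch of
the tree with at most `r` edges; what is left to do at each of the vertices of this branch is
connected, and so is what is left of the current path. The part at the root is singled out, since
it is connected with initial portions of the tour. -/
theorem Tour.exists_trace_eq_union (hγ : ∀ a, Continuous (γ a)) {ℓ : List ι} {c : X} {r : ℕ}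
    (h : Tour γ ℓ c r) (p q : ℝ) :
    ∃ S R, trace γ ℓ p q = S ∪ R ∧ JoinedTo c S ∧ pieceCount R ≤ r + 1 := by
  have hord (p q : ℝ) : (Icc (0 : ℝ) 1 ∩ Icc p q).OrdConnected :=
    ordConnected_Icc.inter ordConnected_Icc
  have hemp {p : ℝ} (hp : 1 < p) (q : ℝ) : Icc (0 : ℝ) 1 ∩ Icc p q = ∅ := by
    ext x
    simp only [mem_inter_iff, mem_Icc, mem_empty_iff_false, iff_false]
    intro h; linarith [h.1.2, h.2.1]
  have one_le (r : ℕ) : (1 : ℕ∞) ≤ r + 1 := le_add_self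
  induction h generalizing p q with
  | nil c r => exact ⟨∅, ∅, by simp [trace], joinedTo_empty _, by simp [pieceCount_empty]⟩
  | @dangling a ℓ c r ha h ih =>
    rcases le_or_gt p 1 with hp | hp
    · exact ⟨_, _, union_comm _ _, h.joinedTo_trace hγ (by linarith),
        (pieceCount_image_le (hγ a) (hord _ _)).trans (one_le r)⟩
    · rw [trace, hemp hp, image_empty, empty_union]
      exact ih _ _
  | @tree a ℓ₁ ℓ₂ c r ha h₁ h₂ ih₁ ih₂ =>
    rw [trace, trace_append, ← union_assoc]
    have hl : (0 : ℝ) ≤ ℓ₁.length := Nat.cast_nonneg _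
    rcases le_or_gt p 1 with hp | hp
    · refine ⟨_, _, union_comm _ _, h₂.joinedTo_trace hγ (by linarith), le_trans ?_ (one_le _)⟩
      rcases lt_or_ge q 1 with hq | hq
      · rw [trace_eq_empty_of_neg ℓ₁ (by linarith), union_empty]
        exact pieceCount_image_le (hγ a) (hord _ _)
      · exact ((joinedTo_image_Icc (hγ a) (hord p q) (x := 1)
          ⟨⟨zero_le_one, le_rfl⟩, hp, hq⟩).union
          (h₁.joinedTo_trace hγ (by linarith))).pieceCount_le
    · rw [hemp hp, image_empty, empty_union]
      rcases le_or_gt (p - 1) ℓ₁.length with hp' | hp'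
      · refine ⟨_, _, union_comm _ _, h₂.joinedTo_trace hγ (by linarith), ?_⟩
        obtain ⟨S, R, hSR, hS, hR⟩ := ih₁ (p - 1) (q - 1)
        rw [hSR]
        calc pieceCount (S ∪ R) ≤ pieceCount S + pieceCount R := pieceCount_union_le _ _
          _ ≤ 1 + (r + 1) := by gcongr; exact hS.pieceCount_le
          _ = _ := by push_cast; rw [add_comm]
      · rw [trace_eq_empty_of_length_lt ℓ₁ hp', empty_union]
        exact ih₂ _ _

theorem Tour.pieceCount_prefix_union_trace_le (hγ : ∀ a, Continuous (γ a)) {ℓ : List ι} {c : X}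
    {r : ℕ} (h : Tour γ ℓ c r) {p q : ℝ} (hp : p ≤ 0) (p' q' : ℝ) :
    pieceCount (trace γ ℓ p q ∪ trace γ ℓ p' q') ≤ r + 2 := by
  obtain ⟨S, R, hSR, hS, hR⟩ := h.exists_trace_eq_union hγ p' q'
  rw [hSR, ← union_assoc]
  calc _ ≤ pieceCount (trace γ ℓ p q ∪ S) + pieceCount R := pieceCount_union_le _ _
    _ ≤ 1 + (r + 1) := by
      gcongr
      exact ((h.joinedTo_trace hγ hp).union hS).pieceCount_le
    _ = _ := by rw [add_comm, add_assoc, one_add_one_eq_two]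

theorem Tour.pieceCount_trace_le (hγ : ∀ a, Continuous (γ a)) {ℓ : List ι} {c : X}
    {r : ℕ} (h : Tour γ ℓ c r) (p q : ℝ) : pieceCount (trace γ ℓ p q) ≤ r + 2 := by
  have := h.pieceCount_prefix_union_trace_le hγ (p := -2) (q := -1) (by norm_num) p q
  rwa [trace_eq_empty_of_neg ℓ (by norm_num : (-1 : ℝ) < 0), empty_union] at this

end Tours

/-! ### Arcs in the cake -/

section Arcs

variable {V E : Type*} {G : CakeGraph V E}

/-- The parameter in the edge at time `x` when the edge is run through forwards (`b = true`) or
backwards; times outside `[0,1]` are moved to the nearest endpoint. -/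
noncomputable def param (b : Bool) (x : ℝ) : unitInterval :=
  bif b then projIcc 0 1 zero_le_one x else unitInterval.symm (projIcc 0 1 zero_le_one x)

/-- The time at which a parameter in the edge is reached, inverse to `param`. -/
noncomputable def time (b : Bool) (y : unitInterval) : ℝ := bif b then y else 1 - y

theorem continuous_param (b : Bool) : Continuous (param b) := by
  cases b
  · exact unitInterval.continuous_symm.comp (continuous_projIcc (h := zero_le_one))
  · exact continuous_projIcc (h := zero_le_one)

theorem continuous_time (b : Bool) : Continuous (time b) := by
  cases b
  · exact continuous_const.sub continuous_subtype_val
  · exact continuous_subtype_val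

theorem time_mem (b : Bool) (y : unitInterval) : time b y ∈ Icc (0 : ℝ) 1 := by
  have := y.2
  cases b <;> simp only [time, cond_true, cond_false, mem_Icc] at * <;> constructor <;> linarith

theorem param_time (b : Bool) (y : unitInterval) : param b (time b y) = y := by
  have h := projIcc_of_mem zero_le_one (time_mem b y)
  cases b
  · simp only [param, cond_false, h]
    ext; simp [time]
  · simp only [param, cond_true, h]
    ext; simp [time]

theorem time_param (b : Bool) {x : ℝ} (hx : x ∈ Icc (0 : ℝ) 1) : time b (param b x) = x := by
  have h := projIcc_of_mem zero_le_one hx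
  cases b <;> simp [param, time, h]

/-- An edge, run through in the direction given by the second component. -/
noncomputable def arc (a : E × Bool) (x : ℝ) : G.Cake := point a.1 (param a.2 x)

variable (G) in
/-- The points of the cake that are vertices. -/
def vertexPoints : Set G.Cake := range fun a : E × Bool => arc a 0

theorem continuous_point (e : E) : Continuous (point (G := G) e) :=
  continuous_quotient_mk'.comp continuous_sigmaMk

theorem continuous_arc (a : E × Bool) : Continuous (arc (G := G) a) :=
  (continuous_point _).comp (continuous_param _)

theorem finite_vertexPoints [Finite E] : (vertexPoints G).Finite := finite_range _

theorem arc_zero_mem (a : E × Bool) : arc a 0 ∈ vertexPoints G := ⟨a, rfl⟩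

theorem arc_one_mem (a : E × Bool) : arc a 1 ∈ vertexPoints G := by
  refine ⟨(a.1, !a.2), ?_⟩
  obtain ⟨e, b⟩ := a
  cases b <;> simp [arc, param]

theorem arc_mem_vertexPoints (a : E × Bool) {x : ℝ} (h : x = 0 ∨ x = 1) :
    arc a x ∈ vertexPoints G := by
  rcases h with rfl | rfl
  exacts [arc_zero_mem a, arc_one_mem a]

theorem mk_eq_mk {p q : (_ : E) × unitInterval} :
    (Quotient.mk G.gluing p : G.Cake) = Quotient.mk G.gluing q ↔
      p = q ∨ ∃ v, G.IsVertexPoint p v ∧ G.IsVertexPoint q v :=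
  Quotient.eq (r := G.gluing)

/-- Outside of the vertices, the points of the cake have unique coordinates. -/
theorem arc_eq_arc {a b : E × Bool} {x y : ℝ} (hx : x ∈ Icc (0 : ℝ) 1) (hy : y ∈ Icc (0 : ℝ) 1)
    (h : arc (G := G) a x = arc b y) : (a.1 = b.1 ∧ (a = b → x = y)) ∨ (x = 0 ∨ x = 1) := by
  rcases mk_eq_mk.1 h with h | ⟨v, h, -⟩
  · left
    simp only [Sigma.mk.injEq, heq_eq_eq] at h
    refine ⟨h.1, ?_⟩
    rintro rfl
    rw [← time_param a.2 hx, h.2, time_param a.2 hy]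
  · right
    have hx' := time_param a.2 hx
    rcases h with ⟨h, -⟩ | ⟨h, -⟩ <;> simp only at h <;> rw [h] at hx' <;> rw [← hx'] <;>
      cases a.2 <;> simp [time]

/-- The part of an arc between two times. -/
def arcPart (G : CakeGraph V E) (a : E × Bool) (p q : ℝ) : Set G.Cake :=
  arc a '' (Icc 0 1 ∩ Icc p q)

theorem arcPart_inter_arcPart {a b : E × Bool} (hab : a.1 ≠ b.1) (p q p' q' : ℝ) :
    arcPart G a p q ∩ arcPart G b p' q' ⊆ vertexPoints G := by
  rintro _ ⟨⟨x, hx, rfl⟩, ⟨y, hy, h⟩⟩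
  rcases arc_eq_arc hx.1 hy.1 h.symm with h | h
  · exact absurd h.1 hab
  · exact arc_mem_vertexPoints a h

theorem arcPart_inter_arcPart_self (a : E × Bool) {q q' : ℝ} (h : q ≤ q') (p u : ℝ) :
    arcPart G a p q ∩ arcPart G a q' u ⊆ insert (arc a q) (vertexPoints G) := by
  rintro _ ⟨⟨x, hx, rfl⟩, ⟨y, hy, hxy⟩⟩
  rcases arc_eq_arc hx.1 hy.1 hxy.symm with h' | h'
  · have h1 := h'.2 rfl
    have : x = q := by linarith [hx.2.2, hy.2.1]
    exact .inl (by rw [this])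
  · exact .inr (arc_mem_vertexPoints a h')

theorem trace_inter_arcPart {a : E × Bool} {ℓ : List (E × Bool)} (ha : a.1 ∉ ℓ.map Prod.fst)
    (p q p' q' : ℝ) : trace (arc (G := G)) ℓ p q ∩ arcPart G a p' q' ⊆ vertexPoints G := by
  induction ℓ generalizing p q with
  | nil => simp [trace]
  | cons b ℓ ih =>
    rw [List.map_cons, List.mem_cons, not_or] at ha
    rw [trace, union_inter_distrib_right]
    exact union_subset (arcPart_inter_arcPart (Ne.symm ha.1) _ _ _ _) (ih ha.2 _ _)

/-- Successive portions of a motion that runs through different edges overlap in finitely many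
points. -/
theorem finite_trace_inter_trace [Finite E] {ℓ : List (E × Bool)} (hℓ : (ℓ.map Prod.fst).Nodup)
    {q q' : ℝ} (h : q ≤ q') (p u : ℝ) :
    (trace (arc (G := G)) ℓ p q ∩ trace arc ℓ q' u).Finite := by
  induction ℓ generalizing p q q' u with
  | nil => simp [trace]
  | cons a ℓ ih =>
    rw [List.map_cons, List.nodup_cons] at hℓ
    rw [trace, trace, union_inter_distrib_right, inter_union_distrib_left,
      inter_union_distrib_left]
    have hV := finite_vertexPoints (G := G)
    refine .union (.union ?_ ?_) (.union ?_ ?_)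
    · exact (hV.insert _).subset (arcPart_inter_arcPart_self a h _ _)
    · rw [inter_comm]; exact hV.subset (trace_inter_arcPart hℓ.1 _ _ _ _)
    · exact hV.subset (trace_inter_arcPart hℓ.1 _ _ _ _)
    · exact ih hℓ.2 (by linarith) _ _

theorem isPiece_empty : IsPiece (∅ : Set G.Cake) := ⟨∅, finite_empty, by simp, by simp⟩

theorem IsPiece.union {α β : Set G.Cake} (hα : IsPiece α) (hβ : IsPiece β) : IsPiece (α ∪ β) := by
  obtain ⟨S, hS, hS', rfl⟩ := hα
  obtain ⟨T, hT, hT', rfl⟩ := hβ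
  exact ⟨S ∪ T, hS.union hT, fun I hI => hI.elim (hS' I) (hT' I), (sUnion_union S T).symm⟩

theorem IsPiece.biUnion {ι : Type*} {s : Finset ι} {α : ι → Set G.Cake}
    (h : ∀ i ∈ s, IsPiece (α i)) : IsPiece (⋃ i ∈ s, α i) := by
  classical
  induction s using Finset.induction_on with
  | empty => simpa using isPiece_empty
  | insert a s ha ih =>
    rw [Finset.set_biUnion_insert]
    exact (h a (Finset.mem_insert_self _ _)).union
      (ih fun i hi => h i (Finset.mem_insert_of_mem hi))

theorem isPiece_arcPart (a : E × Bool) (p q : ℝ) : IsPiece (arcPart G a p q) := by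
  refine ⟨{arcPart G a p q}, finite_singleton _, ?_, by simp⟩
  rintro _ rfl
  refine ⟨a.1, time a.2 ⁻¹' Icc p q, ?_, ?_⟩
  · cases a.2
    · exact ordConnected_Icc.preimage_anti fun x y h =>
        sub_le_sub_left (Subtype.coe_le_coe.2 h) (1 : ℝ)
    · exact ordConnected_Icc.preimage_mono fun x y h =>
        Subtype.coe_le_coe.2 h
  · ext c
    constructor
    · rintro ⟨x, hx, rfl⟩
      exact ⟨param a.2 x, by simpa [time_param a.2 hx.1] using hx.2, rfl⟩
    · rintro ⟨y, hy, rfl⟩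
      exact ⟨time a.2 y, ⟨time_mem _ _, hy⟩, by rw [arc, param_time]⟩

theorem isPiece_trace (ℓ : List (E × Bool)) (p q : ℝ) : IsPiece (trace (arc (G := G)) ℓ p q) := by
  induction ℓ generalizing p q with
  | nil => exact isPiece_empty
  | cons a ℓ ih => exact (isPiece_arcPart a p q).union (ih _ _)

end Arcs

/-! ### Measures of portions of motions -/

section Measures

variable {V E : Type*} {G : CakeGraph V E}

/-- The interior of an edge is embedded as an open subset of the cake. -/
theorem isOpenEmbedding_arc (a : E × Bool) :
    Topology.IsOpenEmbedding fun x : Ioo (0 : ℝ) 1 => arc (G := G) a x := by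
  have key {x : ℝ} {b : E × Bool} {y : ℝ} (hx : x ∈ Ioo (0 : ℝ) 1) (hy : y ∈ Icc (0 : ℝ) 1)
      (h : arc (G := G) a x = arc b y) : a.1 = b.1 ∧ (a = b → x = y) :=
    (arc_eq_arc (Ioo_subset_Icc_self hx) hy h).resolve_right
      (by rintro (rfl | rfl) <;> simp at hx)
  refine .of_continuous_injective_isOpenMap
    ((continuous_arc a).comp continuous_subtype_val) ?_ ?_
  · intro x y h
    exact Subtype.ext ((key x.2 (Ioo_subset_Icc_self y.2) h).2 rfl)
  · intro U hU
    have hU' : IsOpen (Subtype.val '' U) := isOpen_Ioo.isOpenMap_subtype_val U hU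
    have hq : @Topology.IsQuotientMap _ G.Cake _ _ (Quotient.mk G.gluing) :=
      isQuotientMap_quotient_mk'
    rw [← hq.isOpen_preimage, isOpen_sigma_iff]
    intro e
    by_cases he : e = a.1
    · subst he
      convert hU'.preimage (continuous_time a.2) using 1
      ext y
      simp only [mem_preimage, mem_image]
      constructor
      · rintro ⟨x, hx, h⟩
        refine ⟨x, hx, (key x.2 (time_mem a.2 y) (b := a) ?_).2 rfl⟩
        rw [arc.eq_def a (time _ _), param_time]
        exact h
      · rintro ⟨x, hx, h⟩
        refine ⟨x, hx, ?_⟩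
        change arc a x.1 = point a.1 y
        rw [h, arc, param_time]
    · convert isOpen_empty using 1
      ext y
      simp only [mem_preimage, mem_empty_iff_false, iff_false]
      rintro ⟨x, hx, h⟩
      refine he (key x.2 (time_mem true y) (b := (e, true)) ?_).1.symm
      rw [arc.eq_def (e, true), param_time]
      exact h

variable (μ : Measure G.Cake) [NullSingletonClass μ]

/-- A part of an arc agrees almost everywhere with its intersection with the interior of the edge,
on which the arc is a measurable embedding. -/
theorem arcPart_ae_eq (a : E × Bool) (p q : ℝ) :
    (fun x : Ioo (0 : ℝ) 1 => arc (G := G) a x) '' (Subtype.val ⁻¹' Icc p q)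
      =ᵐ[μ] arcPart G a p q := by
  have hsub : (fun x : Ioo (0 : ℝ) 1 => arc (G := G) a x) '' (Subtype.val ⁻¹' Icc p q) ⊆
      arcPart G a p q := by
    rintro _ ⟨x, hx, rfl⟩
    exact ⟨x, ⟨Ioo_subset_Icc_self x.2, hx⟩, rfl⟩
  refine hsub.eventuallyLE.antisymm ?_
  rw [ae_le_set]
  refine measure_mono_null (t := {arc a 0, arc a 1}) ?_ (Set.Finite.measure_zero (by simp) _)
  rintro _ ⟨⟨x, hx, rfl⟩, h⟩
  by_contra h'
  simp only [mem_insert_iff, mem_singleton_iff, not_or] at h'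
  refine h ⟨⟨x, lt_of_le_of_ne hx.1.1 ?_, lt_of_le_of_ne hx.1.2 ?_⟩, hx.2, rfl⟩
  · rintro rfl; exact h'.1 rfl
  · rintro rfl; exact h'.2 rfl

theorem nullMeasurableSet_arcPart (a : E × Bool) (p q : ℝ) :
    NullMeasurableSet (arcPart G a p q) μ :=
  ((isOpenEmbedding_arc a).measurableEmbedding.measurableSet_image'
    (measurableSet_Icc.preimage measurable_subtype_coe)).nullMeasurableSet.congr
    (arcPart_ae_eq μ a p q)

theorem nullMeasurableSet_trace (ℓ : List (E × Bool)) (p q : ℝ) :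
    NullMeasurableSet (trace (arc (G := G)) ℓ p q) μ := by
  induction ℓ generalizing p q with
  | nil => exact .empty
  | cons a ℓ ih => exact (nullMeasurableSet_arcPart μ a p q).union (ih _ _)

variable [IsFiniteMeasure μ]

/-- The measure of a part of an arc is the difference of the values of a continuous function: pull
the measure back to the interior of the edge and take its primitive. -/
theorem exists_continuous_measure_arcPart (a : E × Bool) :
    ∃ φ : ℝ → ℝ, Continuous φ ∧ ∀ p q, p ≤ q → μ.real (arcPart G a p q) = φ q - φ p := by
  let f := fun x : Ioo (0 : ℝ) 1 => arc (G := G) a x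
  have hf : MeasurableEmbedding f := (isOpenEmbedding_arc a).measurableEmbedding
  let ν : Measure ℝ := (μ.comap f).map Subtype.val
  have hν (S : Set ℝ) (hS : MeasurableSet S) : ν S = μ (f '' (Subtype.val ⁻¹' S)) := by
    rw [Measure.map_apply measurable_subtype_coe hS, hf.comap_apply]
  have : IsFiniteMeasure ν := ⟨by rw [hν _ .univ]; exact measure_lt_top _ _⟩
  have : NullSingletonClass ν := ⟨fun x => by
    rw [hν _ (measurableSet_singleton x)]
    refine Set.Subsingleton.measure_zero (Set.Subsingleton.image ?_ _) _
    exact subsingleton_singleton.preimage Subtype.val_injective⟩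
  refine ⟨fun x => ∫ _ in (0 : ℝ)..x, (1 : ℝ) ∂ν,
    (integrable_const (1 : ℝ)).continuous_primitive 0, fun p q hpq => ?_⟩
  have hint (x y : ℝ) : IntervalIntegrable (fun _ => (1 : ℝ)) ν x y :=
    (integrable_const (1 : ℝ)).intervalIntegrable
  rw [intervalIntegral.integral_interval_sub_left (hint _ _) (hint _ _),
    intervalIntegral.integral_of_le hpq, ← integral_Icc_eq_integral_Ioc, setIntegral_const,
    smul_eq_mul, mul_one, measureReal_def, measureReal_def, hν _ measurableSet_Icc,
    measure_congr (arcPart_ae_eq μ a p q)]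

theorem exists_continuous_measure_trace [Finite E] {ℓ : List (E × Bool)}
    (hℓ : (ℓ.map Prod.fst).Nodup) :
    ∃ φ : ℝ → ℝ, Continuous φ ∧
      ∀ p q, p ≤ q → μ.real (trace (arc (G := G)) ℓ p q) = φ q - φ p := by
  induction ℓ with
  | nil => exact ⟨0, continuous_zero, by simp [trace]⟩
  | cons a ℓ ih =>
    rw [List.map_cons, List.nodup_cons] at hℓ
    obtain ⟨φ, hφ, hφ'⟩ := ih hℓ.2
    obtain ⟨ψ, hψ, hψ'⟩ := exists_continuous_measure_arcPart μ a
    refine ⟨fun x => ψ x + φ (x - 1), by fun_prop, fun p q hpq => ?_⟩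
    have h := measureReal_union₀ (μ := μ) (nullMeasurableSet_trace μ ℓ (p - 1) (q - 1))
      (s := arcPart G a p q) (by
        rw [AEDisjoint, inter_comm]
        exact measure_mono_null (trace_inter_arcPart hℓ.1 _ _ _ _)
          (finite_vertexPoints.measure_zero _))
    rw [trace]
    refine h.trans ?_
    rw [hψ' p q hpq, hφ' _ _ (by linarith)]
    ring

end Measures

/-! ### Depth-first tours of connected components -/

section SearchTrees

variable {V E : Type*} {G : CakeGraph V E}

variable (G) in
/-- The vertex at which an oriented edge starts. -/
def source (a : E × Bool) : V := bif a.2 then G.left a.1 else G.right a.1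

variable (G) in
/-- The vertex at which an oriented edge ends. -/
def target (a : E × Bool) : V := bif a.2 then G.right a.1 else G.left a.1

theorem exists_source_target_of_adj {u v : V} (h : G.toSimpleGraph.Adj u v) :
    ∃ a, source G a = u ∧ target G a = v := by
  rcases ((SimpleGraph.fromRel_adj _ _ _).1 h).2 with ⟨e, h1, h2⟩ | ⟨e, h1, h2⟩
  · exact ⟨(e, true), h1, h2⟩
  · exact ⟨(e, false), h2, h1⟩

theorem right_mem_supp_iff (C : G.Component) (e : E) :
    G.right e ∈ C.supp ↔ G.left e ∈ C.supp := by
  by_cases h : G.left e = G.right e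
  · rw [h]
  · exact (C.mem_supp_congr_adj ((SimpleGraph.fromRel_adj _ _ _).2 ⟨h, .inl ⟨e, rfl, rfl⟩⟩)).symm

theorem isVertexPoint_source (a : E × Bool) :
    G.IsVertexPoint ⟨a.1, param a.2 0⟩ (source G a) := by
  obtain ⟨e, b⟩ := a
  cases b <;> simp [IsVertexPoint, param, source]

theorem isVertexPoint_target (a : E × Bool) :
    G.IsVertexPoint ⟨a.1, param a.2 1⟩ (target G a) := by
  obtain ⟨e, b⟩ := a
  cases b <;> simp [IsVertexPoint, param, target]

variable (G) in
/-- Vertices can be located in the cake; an isolated vertex is not a point of the cake and gets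
an arbitrary location. -/
theorem exists_vertex_location [Nonempty E] :
    ∃ P : V → G.Cake, ∀ a : E × Bool, arc a 0 = P (source G a) ∧ arc a 1 = P (target G a) := by
  classical
  refine ⟨fun v => if h : ∃ a : E × Bool, source G a = v then arc h.choose 0
    else arc (Classical.arbitrary _) 0, fun a => ⟨?_, ?_⟩⟩
  · have h : ∃ b : E × Bool, source G b = source G a := ⟨a, rfl⟩
    simp only [dif_pos h]
    have h' := isVertexPoint_source (G := G) h.choose
    rw [h.choose_spec] at h'
    exact mk_eq_mk.2 (.inr ⟨_, isVertexPoint_source a, h'⟩)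
  · have h : ∃ b : E × Bool, source G b = target G a := ⟨(a.1, !a.2), by
      obtain ⟨e, b⟩ := a
      cases b <;> rfl⟩
    simp only [dif_pos h]
    have h' := isVertexPoint_source (G := G) h.choose
    rw [h.choose_spec] at h'
    exact mk_eq_mk.2 (.inr ⟨_, isVertexPoint_target a, h'⟩)

variable (G) in
/-- A spanning tree of height at most `r` of a set `S` of vertices: every vertex `v` of `S` except
the root is reached from its parent by the oriented edge `edge v`. The values of `depth` and `edge`
at other vertices are irrelevant. -/
structure SearchTree (S : Set V) (r : ℕ) where
  /-- The root of the tree. -/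
  root : V
  root_mem : root ∈ S
  /-- The distance from the root. -/
  depth : V → ℕ
  depth_le : ∀ v ∈ S, depth v ≤ r
  /-- The edge from the parent of a vertex to the vertex. -/
  edge : V → E × Bool
  target_edge : ∀ v ∈ S, v ≠ root → target G (edge v) = v
  parent_mem : ∀ v ∈ S, v ≠ root → source G (edge v) ∈ S
  depth_parent : ∀ v ∈ S, v ≠ root → depth (source G (edge v)) + 1 = depth v

/-- Breadth-first search from a vertex in the centre. -/
theorem exists_searchTree [Nonempty E] (C : G.Component) {r : ℕ} (hr : C.toSimpleGraph.radius ≤ r) :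
    Nonempty (SearchTree G C.supp r) := by
  classical
  have : Nonempty C.supp := C.nonempty_supp.to_subtype
  obtain ⟨⟨c, hc⟩, hcr⟩ := C.toSimpleGraph.exists_eccent_eq_radius
  have hstep (v : V) (hv : v ∈ C.supp) (hvc : v ≠ c) : ∃ a, target G a = v ∧
      source G a ∈ C.supp ∧ G.toSimpleGraph.dist c (source G a) + 1 = G.toSimpleGraph.dist c v := by
    obtain ⟨p, hp⟩ := (C.reachable_of_mem_supp hv hc).exists_walk_length_eq_dist
    cases p with
    | nil => exact absurd rfl hvc
    | @cons _ u _ h p =>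
      obtain ⟨a, ha, ha'⟩ := exists_source_target_of_adj h.symm
      have h1 := SimpleGraph.dist_le p
      have h2 := h.diff_dist_adj (u := c)
      rw [SimpleGraph.Walk.length_cons, SimpleGraph.dist_comm] at hp
      rw [SimpleGraph.dist_comm] at h1
      exact ⟨a, ha', ha ▸ (C.mem_supp_congr_adj h).1 hv, by rw [ha]; omega⟩
  choose! f hf using hstep
  refine ⟨⟨c, hc, G.toSimpleGraph.dist c, fun v hv => ?_, f, fun v h h' => (hf v h h').1,
    fun v h h' => (hf v h h').2.1, fun v h h' => (hf v h h').2.2⟩⟩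
  have h : C.toSimpleGraph.edist ⟨c, hc⟩ ⟨v, hv⟩ ≤ r :=
    SimpleGraph.edist_le_eccent.trans (hcr.trans_le hr)
  obtain ⟨p, hp⟩ := SimpleGraph.exists_walk_of_edist_ne_top
    (ne_top_of_le_ne_top (ENat.natCast_ne_top r) h)
  rw [← hp] at h
  refine (SimpleGraph.dist_le (p.map C.toSimpleGraph_hom)).trans ?_
  rw [SimpleGraph.Walk.length_map]
  exact_mod_cast h

namespace SearchTree

variable {S : Set V} {r : ℕ} (T : SearchTree G S r)

theorem edge_injective {v w : V} (hv : v ∈ S) (hv' : v ≠ T.root) (hw : w ∈ S) (hw' : w ≠ T.root)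
    (h : (T.edge v).1 = (T.edge w).1) : v = w := by
  have h1 := T.depth_parent v hv hv'
  have h2 := T.depth_parent w hw hw'
  have h3 := T.target_edge v hv hv'
  have h4 := T.target_edge w hw hw'
  generalize T.edge v = a at *
  generalize T.edge w = b at *
  obtain ⟨e, x⟩ := a
  obtain ⟨e', y⟩ := b
  obtain rfl : e = e' := h
  cases x <;> cases y <;> simp only [source, target, cond_true, cond_false] at * <;>
    first
    | exact h3.symm.trans h4
    | (rw [h4] at h1; rw [h3] at h2; omega)

open Classical in
/-- The vertex at which a tour of the tree runs through the edge `e`: the parent if `e` belongs to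
the tree, and the left endpoint otherwise. -/
noncomputable def owner (e : E) : V :=
  if h : ∃ v ∈ S, v ≠ T.root ∧ (T.edge v).1 = e then source G (T.edge h.choose) else G.left e

theorem owner_edge {v : V} (hv : v ∈ S) (hv' : v ≠ T.root) :
    T.owner (T.edge v).1 = source G (T.edge v) := by
  have h : ∃ w ∈ S, w ≠ T.root ∧ (T.edge w).1 = (T.edge v).1 := ⟨v, hv, hv', rfl⟩
  rw [owner, dif_pos h]
  obtain ⟨h1, h2, h3⟩ := h.choose_spec
  rw [T.edge_injective h1 h2 hv hv' h3]

/-- The vertex `v` lies on the branch from the root to `o`. -/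
def IsAncestor (v o : V) : Prop :=
  ∃ j, (fun w => source G (T.edge w))^[j] o = v ∧ T.depth v + j = T.depth o

theorem IsAncestor.depth_le {v o : V} (h : T.IsAncestor v o) : T.depth v ≤ T.depth o := by
  obtain ⟨j, -, h⟩ := h
  omega

theorem IsAncestor.parent {v o : V} (hv : v ∈ S) (hv' : v ≠ T.root) (h : T.IsAncestor v o) :
    T.IsAncestor (source G (T.edge v)) o := by
  obtain ⟨j, rfl, h⟩ := h
  have := T.depth_parent _ hv hv'
  exact ⟨j + 1, by rw [Function.iterate_succ_apply'], by omega⟩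

theorem IsAncestor.eq_of_depth_eq {v w o : V} (hv : T.IsAncestor v o) (hw : T.IsAncestor w o)
    (h : T.depth v = T.depth w) : v = w := by
  obtain ⟨i, rfl, hi⟩ := hv
  obtain ⟨j, rfl, hj⟩ := hw
  obtain rfl : i = j := by omega
  rfl

/-- The children of a vertex. -/
noncomputable def children [Finite V] (v : V) : List V :=
  (Set.toFinite {w | w ∈ S ∧ w ≠ T.root ∧ source G (T.edge w) = v}).toFinset.toList

/-- The edges outside of the tree that are owned by a vertex. -/
noncomputable def dangling [Finite E] (v : V) : List E :=
  (Set.toFinite {e | G.left e = v ∧ ∀ w ∈ S, w ≠ T.root → (T.edge w).1 ≠ e}).toFinset.toList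

theorem mem_children [Finite V] {v w : V} :
    w ∈ T.children v ↔ w ∈ S ∧ w ≠ T.root ∧ source G (T.edge w) = v := by
  rw [children, Finset.mem_toList, Set.Finite.mem_toFinset, mem_ofPred]

theorem mem_dangling [Finite E] {v : V} {e : E} :
    e ∈ T.dangling v ↔ G.left e = v ∧ ∀ w ∈ S, w ≠ T.root → (T.edge w).1 ≠ e := by
  rw [dangling, Finset.mem_toList, Set.Finite.mem_toFinset, mem_ofPred]

theorem owner_dangling [Finite E] {v : V} {e : E} (h : e ∈ T.dangling v) : T.owner e = v := by
  obtain ⟨h1, h2⟩ := T.mem_dangling.1 h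
  rw [owner, dif_neg, h1]
  rintro ⟨w, hw, hw', h⟩
  exact h2 w hw hw' h

variable [Finite V] [Finite E]

/-- The depth-first tour of the subtree at `v`, down to `k` generations. -/
noncomputable def tour : ℕ → V → List (E × Bool)
  | 0, v => (T.dangling v).map (·, true)
  | k + 1, v => (T.dangling v).map (·, true) ++
      (T.children v).flatMap fun w => T.edge w :: tour k w

theorem tour_isTour {P : V → G.Cake}
    (hP : ∀ a : E × Bool, arc a 0 = P (source G a) ∧ arc a 1 = P (target G a)) (k : ℕ) (v : V) :
    Tour (arc (G := G)) (T.tour k v) (P v) k := by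
  have hdang (v : V) (L : List E) (hL : ∀ e ∈ L, e ∈ T.dangling v) (ℓ : List (E × Bool)) (k : ℕ)
      (h : Tour (arc (G := G)) ℓ (P v) k) :
      Tour (arc (G := G)) (L.map (·, true) ++ ℓ) (P v) k := by
    induction L with
    | nil => exact h
    | cons e L ih =>
      refine .dangling ?_ (ih fun e he => hL e (List.mem_cons_of_mem _ he))
      rw [(hP _).1, ← (T.mem_dangling.1 (hL e List.mem_cons_self)).1]
      rfl
  induction k generalizing v with
  | zero => simpa [tour] using hdang v _ (fun _ h => h) [] 0 (.nil _ _)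
  | succ k ih =>
    refine hdang v _ (fun _ h => h) _ _ ?_
    have (L : List V) (hL : ∀ w ∈ L, w ∈ T.children v) :
        Tour (arc (G := G)) (L.flatMap fun w => T.edge w :: T.tour k w) (P v) (k + 1) := by
      induction L with
      | nil => exact .nil _ _
      | cons w L ihL =>
        obtain ⟨h1, h2, h3⟩ := T.mem_children.1 (hL w List.mem_cons_self)
        rw [List.flatMap_cons]
        refine .tree (by rw [(hP _).1, h3]) ?_ (ihL fun w hw => hL w (List.mem_cons_of_mem _ hw))
        rw [(hP _).2, T.target_edge w h1 h2]
        exact ih w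
    exact this _ fun _ h => h

theorem isAncestor_of_mem_tour {k : ℕ} {v : V} {e : E} (h : e ∈ (T.tour k v).map Prod.fst) :
    T.IsAncestor v (T.owner e) := by
  induction k generalizing v with
  | zero =>
    simp only [tour, List.map_map, List.mem_map, Function.comp_apply, exists_eq_right] at h
    rw [T.owner_dangling h]
    exact ⟨0, rfl, rfl⟩
  | succ k ih =>
    simp only [tour, List.map_append, List.map_map, List.map_flatMap, List.mem_append,
      List.mem_map, List.mem_flatMap, Function.comp_apply, exists_eq_right, List.map_cons,
      List.mem_cons] at h ih
    rcases h with h | ⟨w, hw, rfl | h⟩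
    · rw [T.owner_dangling h]
      exact ⟨0, rfl, rfl⟩
    · obtain ⟨h1, h2, rfl⟩ := T.mem_children.1 hw
      rw [T.owner_edge h1 h2]
      exact ⟨0, rfl, rfl⟩
    · obtain ⟨h1, h2, rfl⟩ := T.mem_children.1 hw
      exact (ih h).parent T h1 h2

/-- Subtrees at different vertices of the same depth have no common descendant, so no edge is
visited twice. -/
theorem nodup_tour (k : ℕ) (v : V) : ((T.tour k v).map Prod.fst).Nodup := by
  have hdang (v : V) : (((T.dangling v).map (·, true)).map Prod.fst).Nodup := by
    rw [List.map_map]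
    exact (Finset.nodup_toList _).map fun _ _ h => h
  have hlt {v w : V} (hw : w ∈ T.children v) : T.depth v < T.depth w := by
    obtain ⟨h1, h2, rfl⟩ := T.mem_children.1 hw
    have := T.depth_parent w h1 h2
    omega
  induction k generalizing v with
  | zero => exact hdang v
  | succ k ih =>
    rw [tour, List.map_append, List.nodup_append, List.map_flatMap, List.nodup_flatMap]
    refine ⟨hdang v, ⟨fun w hw => ?_, ?_⟩, ?_⟩
    · rw [List.map_cons, List.nodup_cons]
      refine ⟨fun h => ?_, ih w⟩
      have h' := (T.isAncestor_of_mem_tour h).depth_le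
      obtain ⟨h1, h2, rfl⟩ := T.mem_children.1 hw
      rw [T.owner_edge h1 h2] at h'
      exact absurd h' (hlt hw).not_ge
    · refine (Finset.nodup_toList _).imp_of_mem fun {w w'} hw hw' hne => ?_
      change w ∈ T.children v at hw
      change w' ∈ T.children v at hw'
      have hv := hlt hw
      have hv' := hlt hw'
      obtain ⟨h1, h2, h3⟩ := T.mem_children.1 hw
      obtain ⟨h1', h2', h3'⟩ := T.mem_children.1 hw'
      have hd : T.depth w = T.depth w' := by
        rw [← T.depth_parent w h1 h2, ← T.depth_parent w' h1' h2', h3, h3']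
      intro e he he'
      simp only [List.map_cons, List.mem_cons] at he he'
      rcases he with rfl | he <;> rcases he' with he' | he'
      · exact hne (T.edge_injective h1 h2 h1' h2' he')
      · have := (T.isAncestor_of_mem_tour he').depth_le
        rw [T.owner_edge h1 h2, h3] at this
        omega
      · subst he'
        have := (T.isAncestor_of_mem_tour he).depth_le
        rw [T.owner_edge h1' h2', h3'] at this
        omega
      · exact hne ((T.isAncestor_of_mem_tour he).eq_of_depth_eq T (T.isAncestor_of_mem_tour he') hd)
    · rintro e he _ he' rfl
      simp only [List.map_map, List.mem_map, Function.comp_apply, exists_eq_right] at he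
      obtain ⟨w, hw, he'⟩ := List.mem_flatMap.1 he'
      obtain ⟨h1, h2, h3⟩ := T.mem_children.1 hw
      simp only [List.map_cons, List.mem_cons] at he'
      rcases he' with rfl | he'
      · exact (T.mem_dangling.1 he).2 w h1 h2 rfl
      · have := (T.isAncestor_of_mem_tour he').depth_le
        rw [T.owner_dangling he] at this
        exact absurd this (hlt hw).not_ge

theorem left_mem_of_mem_tour {k : ℕ} {v : V} (hv : v ∈ S) {e : E}
    (h : e ∈ (T.tour k v).map Prod.fst) : G.left e ∈ S := by
  induction k generalizing v with
  | zero =>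
    simp only [tour, List.map_map, List.mem_map, Function.comp_apply, exists_eq_right] at h
    rwa [(T.mem_dangling.1 h).1]
  | succ k ih =>
    rw [tour, List.map_append, List.mem_append, List.map_flatMap, List.mem_flatMap] at h
    rcases h with h | ⟨w, hw, h⟩
    · simp only [List.map_map, List.mem_map, Function.comp_apply, exists_eq_right] at h
      rwa [(T.mem_dangling.1 h).1]
    · obtain ⟨h1, h2, h3⟩ := T.mem_children.1 hw
      simp only [List.map_cons, List.mem_cons] at h
      rcases h with rfl | h
      · have h4 := T.target_edge w h1 h2
        have h5 := T.parent_mem w h1 h2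
        generalize T.edge w = a at *
        obtain ⟨e, b⟩ := a
        cases b
        · exact (show G.left e = w from h4) ▸ h1
        · exact h5
      · exact ih h1 h

/-- A tour of the subtree at a vertex that is deep enough to exhaust it is part of the tour of the
whole tree. -/
theorem mem_tour_root {v : V} (hv : v ∈ S) {e : E}
    (h : ∀ k, r ≤ k + T.depth v → e ∈ (T.tour k v).map Prod.fst) :
    e ∈ (T.tour r T.root).map Prod.fst := by
  induction hn : T.depth v generalizing v with
  | zero =>
    by_cases hroot : v = T.root
    · exact hroot ▸ h r (by omega)
    · have := T.depth_parent v hv hroot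
      omega
  | succ n ih =>
    by_cases hroot : v = T.root
    · exact hroot ▸ h r (by omega)
    · have h1 := T.depth_parent v hv hroot
      have h2 := T.depth_le v hv
      refine ih (T.parent_mem v hv hroot) (fun k hk => ?_) (by omega)
      obtain ⟨k, rfl⟩ := Nat.exists_eq_add_one_of_ne_zero (show k ≠ 0 by omega)
      rw [tour, List.map_append, List.mem_append, List.map_flatMap, List.mem_flatMap]
      refine .inr ⟨v, T.mem_children.2 ⟨hv, hroot, rfl⟩, ?_⟩
      rw [List.map_cons]
      exact List.mem_cons_of_mem _ (h k (by omega))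

theorem mem_tour_iff (e : E) : e ∈ (T.tour r T.root).map Prod.fst ↔ G.left e ∈ S := by
  refine ⟨T.left_mem_of_mem_tour T.root_mem, fun he => ?_⟩
  by_cases h : ∃ w ∈ S, w ≠ T.root ∧ (T.edge w).1 = e
  · obtain ⟨w, hw, hw', rfl⟩ := h
    refine T.mem_tour_root (T.parent_mem w hw hw') fun k hk => ?_
    have h1 := T.depth_parent w hw hw'
    have h2 := T.depth_le w hw
    obtain ⟨k, rfl⟩ := Nat.exists_eq_add_one_of_ne_zero (show k ≠ 0 by omega)
    rw [tour, List.map_append, List.mem_append, List.map_flatMap, List.mem_flatMap]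
    refine .inr ⟨w, T.mem_children.2 ⟨hw, hw', rfl⟩, ?_⟩
    rw [List.map_cons]
    exact List.mem_cons_self
  · have hd : e ∈ T.dangling (G.left e) :=
      T.mem_dangling.2 ⟨rfl, fun w hw hw' hwe => h ⟨w, hw, hw', hwe⟩⟩
    refine T.mem_tour_root he fun k _ => ?_
    cases k <;> simp [tour, hd]

end SearchTree

/-- A connected component of radius at most `r` has a depth-first tour of height at most `r` that
runs through each of its edges exactly once. -/
theorem exists_tour [Finite V] [Finite E] [Nonempty E] (C : G.Component) {r : ℕ}
    (hr : C.toSimpleGraph.radius ≤ r) :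
    ∃ (ℓ : List (E × Bool)) (c : G.Cake), Tour arc ℓ c r ∧ (ℓ.map Prod.fst).Nodup ∧
      ∀ e, e ∈ ℓ.map Prod.fst ↔ G.left e ∈ C.supp := by
  obtain ⟨T⟩ := exists_searchTree C hr
  obtain ⟨P, hP⟩ := exists_vertex_location G
  exact ⟨_, _, T.tour_isTour hP r T.root, T.nodup_tour _ _, T.mem_tour_iff⟩

end SearchTrees

/-! ### Common chords of two monotone functions -/

/-- A continuous function on a circle of length one takes the same value at two points that are
`t` apart. -/
theorem exists_chord {h : ℝ → ℝ} (hc : ContinuousOn h (Icc 0 1)) (h01 : h 0 = h 1) {t : ℝ}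
    (ht0 : 0 ≤ t) (ht1 : t ≤ 1) :
    ∃ s ∈ Icc (0 : ℝ) 1, (s + t ≤ 1 ∧ h (s + t) = h s) ∨ (1 ≤ s + t ∧ h (s + t - 1) = h s) := by
  let H : ℝ → ℝ := IccExtend (zero_le_one (α := ℝ)) ((Icc 0 1).domRestrict h)
  have hH : Continuous H := hc.domRestrict.Icc_extend'
  have hHh (x : ℝ) (hx : x ∈ Icc (0 : ℝ) 1) : H x = h x := IccExtend_of_mem _ _ hx
  let g : ℝ → ℝ := fun s => if s ≤ 1 - t then H (s + t) - H s else H (s + t - 1) - H s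
  have hg : Continuous g := by
    refine Continuous.if_le (by fun_prop) (by fun_prop) continuous_id continuous_const ?_
    rintro _ rfl
    simp only [sub_add_cancel, sub_self]
    rw [hHh 1 (by simp), hHh 0 (by simp), h01]
  have hgm (s : ℝ) (hs : s ∈ Icc (0 : ℝ) 1) : ∃ s' ∈ Icc (0 : ℝ) 1, g s = H s' - H s := by
    by_cases h : s ≤ 1 - t
    · exact ⟨s + t, ⟨by linarith [hs.1], by linarith⟩, if_pos h⟩
    · exact ⟨s + t - 1, ⟨by linarith, by linarith [hs.2]⟩, if_neg h⟩
  have hne : (Icc (0 : ℝ) 1).Nonempty := ⟨0, by simp⟩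
  -- The chord difference is nonpositive at a maximum of the function, nonnegative at a minimum.
  obtain ⟨a, ha, hamax⟩ := isCompact_Icc.exists_isMaxOn hne hH.continuousOn
  obtain ⟨b, hb, hbmin⟩ := isCompact_Icc.exists_isMinOn hne hH.continuousOn
  have hga : g a ≤ 0 := by
    obtain ⟨s', hs', h⟩ := hgm a ha
    have := hamax hs'
    simp only [mem_ofPred_eq] at this
    linarith
  have hgb : 0 ≤ g b := by
    obtain ⟨s', hs', h⟩ := hgm b hb
    have := hbmin hs'
    simp only [mem_ofPred_eq] at this
    linarith
  obtain ⟨s, hs, hgs⟩ := isPreconnected_Icc.intermediate_value ha hb hg.continuousOn ⟨hga, hgb⟩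
  refine ⟨s, hs, ?_⟩
  by_cases h : s ≤ 1 - t
  · left
    have h1 : g s = H (s + t) - H s := if_pos h
    rw [hHh _ ⟨by linarith [hs.1], by linarith⟩, hHh s hs] at h1
    exact ⟨by linarith, by linarith⟩
  · right
    have h1 : g s = H (s + t - 1) - H s := if_neg h
    rw [hHh _ ⟨by linarith, by linarith [hs.2]⟩, hHh s hs] at h1
    exact ⟨by linarith, by linarith⟩

/-- Two continuous distribution functions on `[0,N]` have a common interval of mass `t`, or one of
mass `1 - t`. For the proof, `F` is expressed as a function of the mean of `F` and `G`. -/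
theorem exists_common_interval {N : ℝ} (hN : 0 ≤ N) {F G : ℝ → ℝ} (hF : Continuous F)
    (hG : Continuous G) (hFm : Monotone F) (hGm : Monotone G) (hF1 : F N - F 0 = 1)
    (hG1 : G N - G 0 = 1) {t : ℝ} (ht0 : 0 ≤ t) (ht1 : t ≤ 1) :
    ∃ p q, 0 ≤ p ∧ p ≤ q ∧ q ≤ N ∧
      ((F q - F p = t ∧ G q - G p = t) ∨ (F q - F p = 1 - t ∧ G q - G p = 1 - t)) := by
  let K : ℝ → ℝ := fun x => ((F x - F 0) + (G x - G 0)) / 2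
  have hK : Continuous K := by fun_prop
  have hK0 : K 0 = 0 := by simp [K]
  have hKN : K N = 1 := by simp only [K, hF1, hG1]; norm_num
  have hFK {a b : ℝ} (hab : a ≤ b) : 0 ≤ F b - F a ∧ F b - F a ≤ 2 * (K b - K a) := by
    have h1 := hFm hab
    have h2 := hGm hab
    constructor
    · linarith
    · simp only [K]; linarith
  have hFK_eq {a b : ℝ} (hab : K a = K b) : F a = F b := by
    rcases le_total a b with h | h <;> have := hFK h <;> rw [hab] at this <;>
      linarith [this.1, this.2]
  have hsurj (s : ℝ) (hs : s ∈ Icc (0 : ℝ) 1) : ∃ x ∈ Icc 0 N, K x = s := by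
    have := intermediate_value_Icc hN hK.continuousOn
    rw [hK0, hKN] at this
    exact this hs
  choose! x hx hKx using hsurj
  have hxm {s s' : ℝ} (hs : s ∈ Icc (0 : ℝ) 1) (hs' : s' ∈ Icc (0 : ℝ) 1) (h : s < s') :
      x s ≤ x s' := by
    by_contra! hlt
    have := hFK hlt.le
    rw [hKx s hs, hKx s' hs'] at this
    linarith [this.1, this.2]
  have hlip {s s' : ℝ} (hs : s ∈ Icc (0 : ℝ) 1) (hs' : s' ∈ Icc (0 : ℝ) 1) :
      |F (x s') - F (x s)| ≤ 2 * |s' - s| := by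
    have key {s s' : ℝ} (hs : s ∈ Icc (0 : ℝ) 1) (hs' : s' ∈ Icc (0 : ℝ) 1) (h : s < s') :
        |F (x s') - F (x s)| ≤ 2 * |s' - s| := by
      have := hFK (hxm hs hs' h)
      rw [hKx s hs, hKx s' hs'] at this
      rw [abs_of_nonneg this.1, abs_of_pos (sub_pos.2 h)]
      exact this.2
    rcases lt_trichotomy s s' with h | rfl | h
    · exact key hs hs' h
    · simp
    · rw [abs_sub_comm, abs_sub_comm s']
      exact key hs' hs h
  have hcont : ContinuousOn (fun s => F (x s) - s) (Icc 0 1) := by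
    refine ContinuousOn.sub ?_ continuousOn_id
    exact (LipschitzOnWith.of_dist_le_mul (K := 2) fun s' hs' s hs => hlip hs hs').continuousOn
  have h0 : F (x 0) = F 0 := hFK_eq (by rw [hKx 0 (by simp), hK0])
  have h1 : F (x 1) = F N := hFK_eq (by rw [hKx 1 (by simp), hKN])
  obtain ⟨s, hs, h⟩ := exists_chord hcont (by simp only [h0, h1]; linarith) ht0 ht1
  have hle {s s' : ℝ} (hs : s ∈ Icc (0 : ℝ) 1) (hs' : s' ∈ Icc (0 : ℝ) 1) (h : s ≤ s') :
      x s ≤ x s' := by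
    rcases h.eq_or_lt with rfl | h
    exacts [le_rfl, hxm hs hs' h]
  rcases h with ⟨hst, h⟩ | ⟨hst, h⟩
  · have hs' : s + t ∈ Icc (0 : ℝ) 1 := ⟨by linarith [hs.1], hst⟩
    refine ⟨x s, x (s + t), (hx s hs).1, hle hs hs' (by linarith), (hx _ hs').2, .inl ?_⟩
    have e1 := hKx s hs
    have e2 := hKx _ hs'
    simp only [K] at e1 e2
    constructor <;> linarith
  · have hs' : s + t - 1 ∈ Icc (0 : ℝ) 1 := ⟨by linarith, by linarith [hs.2]⟩
    refine ⟨x (s + t - 1), x s, (hx _ hs').1, hle hs' hs (by linarith), (hx s hs).2, .inr ?_⟩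
    have e1 := hKx s hs
    have e2 := hKx _ hs'
    simp only [K] at e1 e2
    constructor <;> linarith

/-! ### Sweeping one component -/

section Sweeps

variable {V E : Type*} {G : CakeGraph V E}

theorem Component.disjoint_cake {C D : G.Component} (h : C ≠ D) : Disjoint C.cake D.cake := by
  have hv (K : G.Component) {e : E} {x : unitInterval} {v : V} (hv : G.IsVertexPoint ⟨e, x⟩ v) :
      v ∈ K.supp ↔ G.left e ∈ K.supp := by
    rcases hv with ⟨-, rfl⟩ | ⟨-, rfl⟩
    · rfl
    · exact right_mem_supp_iff K e
  rw [Set.disjoint_left]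
  rintro _ ⟨e, x, he, rfl⟩ ⟨e', x', he', hp⟩
  refine h (((C.mem_supp_iff (G.left e')).1 ?_).symm.trans ((D.mem_supp_iff _).1 he'))
  rcases mk_eq_mk.1 hp with hp | ⟨v, h1, h2⟩
  · simp only [Sigma.mk.injEq] at hp
    rwa [← hp.1]
  · rwa [← hv C h2, hv C h1]

theorem iUnion_cake : ⋃ C : G.Component, C.cake = univ := by
  refine eq_univ_of_forall fun c => ?_
  obtain ⟨⟨e, x⟩, rfl⟩ := Quotient.exists_rep c
  exact mem_iUnion.2 ⟨G.toSimpleGraph.connectedComponentMk (G.left e), e, x, rfl, rfl⟩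

/-- The part of the cake belonging to `C` is swept during the time interval `[0,1]`, where `T p q`
is the set swept between the times `p` and `q`. The bounds on the number of connected pieces are
those obtained from a depth-first tour of height `r`. -/
structure IsSweep (C : G.Component) (r : ℕ) (T : ℝ → ℝ → Set G.Cake) : Prop where
  isPiece (p q : ℝ) : IsPiece (T p q)
  full {p q : ℝ} (hp : p ≤ 0) (hq : 1 ≤ q) : T p q = C.cake
  union {p q u : ℝ} (hpq : p ≤ q) (hqu : q ≤ u) : T p q ∪ T q u = T p u
  finite_inter {q q' : ℝ} (h : q ≤ q') (p u : ℝ) : (T p q ∩ T q' u).Finite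
  nullMeasurableSet (μ : Measure G.Cake) [NullSingletonClass μ] (p q : ℝ) :
    NullMeasurableSet (T p q) μ
  exists_continuous_measure (μ : Measure G.Cake) [NullSingletonClass μ] [IsFiniteMeasure μ] :
    ∃ φ : ℝ → ℝ, Continuous φ ∧ ∀ p q, p ≤ q → μ.real (T p q) = φ q - φ p
  pieceCount_prefix {p : ℝ} (hp : p ≤ 0) (q : ℝ) : pieceCount (T p q) ≤ 1
  pieceCount_le (p q : ℝ) : pieceCount (T p q) ≤ r + 2
  pieceCount_prefix_union {p : ℝ} (hp : p ≤ 0) (q p' q' : ℝ) :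
    pieceCount (T p q ∪ T p' q') ≤ r + 2

theorem exists_isSweep [Finite V] [Finite E] [Nonempty E] (C : G.Component) {r : ℕ}
    (hr : C.toSimpleGraph.radius ≤ r) : ∃ T, IsSweep C r T := by
  obtain ⟨ℓ, c, hℓ, hnodup, hmem⟩ := exists_tour C hr
  have h0 : (0 : ℝ) ≤ ℓ.length := Nat.cast_nonneg _
  have hγ (a : E × Bool) : Continuous (arc (G := G) a) := continuous_arc a
  refine ⟨fun p q => trace arc ℓ (ℓ.length * p) (ℓ.length * q),
    ⟨?_, ?_, ?_, ?_, ?_, ?_, ?_, ?_, ?_⟩⟩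
  · exact fun p q => isPiece_trace _ _ _
  · intro p q hp hq
    rw [trace_full ℓ (mul_nonpos_of_nonneg_of_nonpos h0 hp) (le_mul_of_one_le_right h0 hq)]
    ext c
    simp only [mem_iUnion, exists_prop]
    constructor
    · rintro ⟨a, ha, x, -, rfl⟩
      exact ⟨a.1, _, (hmem a.1).1 (List.mem_map_of_mem ha), rfl⟩
    · rintro ⟨e, x, he, rfl⟩
      obtain ⟨a, ha, rfl⟩ := List.mem_map.1 ((hmem e).2 he)
      exact ⟨a, ha, time a.2 x, time_mem _ _, by rw [arc, param_time]⟩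
  · exact fun hpq hqu => trace_union ℓ (by gcongr) (by gcongr)
  · exact fun h p u => finite_trace_inter_trace hnodup (by gcongr) _ _
  · exact fun μ _ p q => nullMeasurableSet_trace μ _ _ _
  · intro μ _ _
    obtain ⟨φ, hφ, hφ'⟩ := exists_continuous_measure_trace μ hnodup
    exact ⟨fun x => φ (ℓ.length * x), by fun_prop, fun p q hpq => hφ' _ _ (by gcongr)⟩
  · exact fun hp q => (hℓ.joinedTo_trace hγ (mul_nonpos_of_nonneg_of_nonpos h0 hp)).pieceCount_le
  · exact fun p q => hℓ.pieceCount_trace_le hγ _ _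
  · exact fun hp q p' q' =>
      hℓ.pieceCount_prefix_union_trace_le hγ (mul_nonpos_of_nonneg_of_nonpos h0 hp) _ _

/-- The pieces `A` and `B` divide the set `K`, and `A` agrees with `S` up to finitely many
points. -/
structure IsCut (K S A B : Set G.Cake) : Prop where
  left : IsPiece A
  right : IsPiece B
  union : A ∪ B = K
  inter : (A ∩ B).Finite
  symmDiff : (symmDiff A S).Finite

namespace IsSweep

variable {C : G.Component} {r : ℕ} {T : ℝ → ℝ → Set G.Cake} (hT : IsSweep C r T) {a b : ℝ}
include hT

theorem isPiece_cake : IsPiece C.cake := hT.full le_rfl le_rfl ▸ hT.isPiece 0 1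

theorem pieceCount_cake : pieceCount C.cake ≤ 1 :=
  hT.full le_rfl le_rfl ▸ hT.pieceCount_prefix le_rfl 1

/-- Only finitely many points are swept before the time `0`, since all of them are swept again
later. -/
theorem finite_of_le_zero (hab : a ≤ b) (hb : b ≤ 0) : (T a b).Finite := by
  refine (hT.finite_inter (le_refl b) a 1).subset (subset_inter subset_rfl ?_)
  rw [hT.full hb le_rfl, ← hT.full (hab.trans hb) le_rfl,
    ← hT.union hab (hb.trans zero_le_one)]
  exact subset_union_left

theorem finite_of_one_le (hab : a ≤ b) (ha : 1 ≤ a) : (T a b).Finite := by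
  refine (hT.finite_inter (le_refl a) 0 b).subset (subset_inter ?_ subset_rfl)
  rw [hT.full le_rfl ha, ← hT.full le_rfl (ha.trans hab),
    ← hT.union (zero_le_one.trans ha) hab]
  exact subset_union_right

theorem isCut_empty_cake (h : (T a b).Finite) : IsCut C.cake (T a b) ∅ C.cake :=
  ⟨isPiece_empty, hT.isPiece_cake, empty_union _, by simp,
    by rwa [← bot_eq_empty, bot_symmDiff]⟩

theorem isCut_cake_empty (ha : a ≤ 0) (hb : 1 ≤ b) : IsCut C.cake (T a b) C.cake ∅ :=
  ⟨hT.isPiece_cake, isPiece_empty, union_empty _, by simp, by simp [hT.full ha hb]⟩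

theorem isCut_suffix (ha : 0 ≤ a) (hab : a ≤ b) (hb : 1 ≤ b) :
    IsCut C.cake (T a b) (T a b) (T 0 a) :=
  ⟨hT.isPiece _ _, hT.isPiece _ _, by rw [union_comm, hT.union ha hab, hT.full le_rfl hb],
    by rw [inter_comm]; exact hT.finite_inter le_rfl _ _, by simp⟩

theorem isCut_prefix (ha : a ≤ 0) (hab : a ≤ b) (hb : b ≤ 1) :
    IsCut C.cake (T a b) (T a b) (T b 1) :=
  ⟨hT.isPiece _ _, hT.isPiece _ _, by rw [hT.union hab hb, hT.full ha le_rfl],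
    hT.finite_inter le_rfl _ _, by simp⟩

theorem isCut_middle (ha : 0 ≤ a) (hab : a ≤ b) (hb : b ≤ 1) :
    IsCut C.cake (T a b) (T a b) (T 0 a ∪ T b 1) := by
  refine ⟨hT.isPiece _ _, (hT.isPiece _ _).union (hT.isPiece _ _), ?_, ?_, by simp⟩
  · rw [← union_assoc, union_comm (T a b), hT.union ha hab, hT.union (ha.trans hab) hb,
      hT.full le_rfl le_rfl]
  · rw [inter_union_distrib_left, inter_comm (T a b) (T 0 a)]
    exact (hT.finite_inter le_rfl _ _).union (hT.finite_inter le_rfl _ _)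

end IsSweep

end Sweeps

/-! ### Cutting the cake at two times -/

section Division

variable {V E : Type*} {G : CakeGraph V E}

/-- The assertion about the division of the components of the cake, which is symmetric in the
two agents: all components except one, or two, are assigned wholly, and the numbers of connected
pieces of the exceptional components are bounded. -/
def HasFewPieces (r : ℕ) (α β : Set G.Cake) : Prop :=
  (∃ C : G.Component, (∀ K : G.Component, K ≠ C → K.Whole α β) ∧
      numPieces (α ∩ C.cake) ≤ r + 2 ∧ numPieces (β ∩ C.cake) ≤ r + 2) ∨
    (∃ C D : G.Component, C ≠ D ∧ (∀ K : G.Component, K ≠ C → K ≠ D → K.Whole α β) ∧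
      numPieces (α ∩ (C.cake ∪ D.cake)) ≤ r + 3 ∧ numPieces (β ∩ (C.cake ∪ D.cake)) ≤ r + 3)

theorem Component.Whole.symm {K : G.Component} {α β : Set G.Cake} (h : K.Whole α β) :
    K.Whole β α := Or.symm h

theorem HasFewPieces.symm {r : ℕ} {α β : Set G.Cake} (h : HasFewPieces r α β) :
    HasFewPieces r β α := by
  rcases h with ⟨C, h1, h2, h3⟩ | ⟨C, D, h0, h1, h2, h3⟩
  · exact .inl ⟨C, fun K hK => (h1 K hK).symm, h3, h2⟩
  · exact .inr ⟨C, D, h0, fun K hK hK' => (h1 K hK hK').symm, h3, h2⟩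

theorem IsDivision.symm {α β : Set G.Cake} (h : IsDivision α β) : IsDivision β α :=
  ⟨h.right, h.left, union_comm α β ▸ h.union, inter_comm α β ▸ h.inter⟩

/-- The components are swept one after the other, the component with number `i` during the time
interval `[i, i + 1]`. One agent gets what is swept between the times `p` and `q`, except for
finitely many points, and the other agent gets the rest. -/
theorem exists_division {s r : ℕ} (C : Fin s ≃ G.Component) {T : Fin s → ℝ → ℝ → Set G.Cake}
    (hT : ∀ i, IsSweep (C i) r (T i)) {p q : ℝ} (hp : 0 ≤ p) (hpq : p ≤ q) (hq : q ≤ s)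
    (hs : 0 < s) :
    ∃ α β, IsDivision α β ∧
      (∀ (μ : Measure G.Cake) [IsFiniteMeasure μ] [NullSingletonClass μ],
        NullMeasurableSet α μ ∧ μ.real α = ∑ i : Fin s, μ.real (T i (p - i) (q - i))) ∧
      numPieces α + numPieces β ≤ s + 2 * r + 4 ∧ HasFewPieces r α β := by
  classical
  -- The number of the component swept at time `x`; the minimum matters only for `x = s`.
  have hindex (x : ℝ) (hx : x ≤ s) (h0 : 0 ≤ x) :
      ∃ j : Fin s, (j : ℕ) = min ⌊x⌋₊ (s - 1) ∧ (j : ℝ) ≤ x ∧ x ≤ j + 1 := by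
    refine ⟨⟨min ⌊x⌋₊ (s - 1), by omega⟩, rfl, ?_, ?_⟩
    · exact (Nat.cast_le.2 (min_le_left _ _)).trans (Nat.floor_le h0)
    · simp only
      rcases le_total ⌊x⌋₊ (s - 1) with h | h
      · rw [min_eq_left h]
        exact (Nat.lt_floor_add_one x).le
      · rw [min_eq_right h, Nat.cast_sub (by omega)]
        simpa using hx
  obtain ⟨j, hj, hjp, hpj⟩ := hindex p (hpq.trans hq) hp
  obtain ⟨k, hk, hkq, hqk⟩ := hindex q hq (hp.trans hpq)
  have hjk : j ≤ k := by
    rw [Fin.le_def, hj, hk]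
    exact min_le_min_right _ (Nat.floor_le_floor hpq)
  have hlt {i i' : Fin s} (h : i < i') : (i : ℝ) + 1 ≤ i' := by
    exact_mod_cast Nat.succ_le_of_lt (Fin.lt_def.1 h)
  -- The cut of the component with number `i`; the times `p` and `q` fall into the components with
  -- the numbers `j` and `k`. Treating the other components as wholes, even if `p` or `q` is the time
  -- of transition to them, avoids stray endpoints.
  have hcut (i : Fin s) : ∃ A B, IsCut (C i).cake (T i (p - i) (q - i)) A B ∧
      (i ≠ j → i ≠ k → (A = (C i).cake ∧ B = ∅) ∨ (A = ∅ ∧ B = (C i).cake)) ∧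
      (i = j → i ≠ k → pieceCount A ≤ r + 2 ∧ pieceCount B ≤ 1) ∧
      (i ≠ j → i = k → pieceCount A ≤ 1 ∧ pieceCount B ≤ r + 2) ∧
      (i = j → i = k → pieceCount A ≤ r + 2 ∧ pieceCount B ≤ r + 2) := by
    have hab : p - i ≤ q - i := by linarith
    rcases lt_trichotomy i j with hij | rfl | hij
    · have hik := hij.trans_le hjk
      have := hlt hij
      exact ⟨_, _, (hT i).isCut_empty_cake ((hT i).finite_of_one_le hab (by linarith)),
        fun _ _ => .inr ⟨rfl, rfl⟩, fun h => absurd h hij.ne, fun _ h => absurd h hik.ne,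
        fun h => absurd h hij.ne⟩
    · rcases hjk.eq_or_lt with rfl | hik
      · exact ⟨_, _, (hT i).isCut_middle (by linarith) hab (by linarith),
          fun h => absurd rfl h, fun _ h => absurd rfl h, fun h => absurd rfl h,
          fun _ _ => ⟨(hT i).pieceCount_le _ _, (hT i).pieceCount_prefix_union le_rfl _ _ _⟩⟩
      · have := hlt hik
        exact ⟨_, _, (hT i).isCut_suffix (by linarith) hab (by linarith),
          fun h => absurd rfl h,
          fun _ _ => ⟨(hT i).pieceCount_le _ _, (hT i).pieceCount_prefix le_rfl _⟩,
          fun h => absurd rfl h, fun _ h => absurd h hik.ne⟩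
    · have hij' := hlt hij
      rcases lt_trichotomy i k with hik | rfl | hik
      · have := hlt hik
        exact ⟨_, _, (hT i).isCut_cake_empty (by linarith) (by linarith),
          fun _ _ => .inl ⟨rfl, rfl⟩, fun h => absurd h hij.ne', fun _ h => absurd h hik.ne,
          fun h => absurd h hij.ne'⟩
      · exact ⟨_, _, (hT i).isCut_prefix (by linarith) hab (by linarith),
          fun _ h => absurd rfl h, fun _ h => absurd rfl h,
          fun _ _ => ⟨(hT i).pieceCount_prefix (by linarith) _, (hT i).pieceCount_le _ _⟩,
          fun h => absurd h hij.ne'⟩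
      · have := hlt hik
        exact ⟨_, _, (hT i).isCut_empty_cake ((hT i).finite_of_le_zero hab (by linarith)),
          fun _ _ => .inr ⟨rfl, rfl⟩, fun h => absurd h hij.ne', fun _ h => absurd h hik.ne',
          fun h => absurd h hij.ne'⟩
  choose A B hAB hwhole hj' hk' hjk' using hcut
  have hA (i : Fin s) : A i ⊆ (C i).cake := (hAB i).union ▸ subset_union_left
  have hB (i : Fin s) : B i ⊆ (C i).cake := (hAB i).union ▸ subset_union_right
  have hdisj {i i' : Fin s} (h : i ≠ i') : Disjoint (C i).cake (C i').cake :=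
    Component.disjoint_cake (C.injective.ne h)
  -- Restricting a union over the components to one component.
  have hinter {S : Fin s → Set G.Cake} (hS : ∀ i, S i ⊆ (C i).cake) (i : Fin s) :
      (⋃ i ∈ Finset.univ, S i) ∩ (C i).cake = S i := by
    ext c
    simp only [mem_inter_iff, mem_iUnion, Finset.mem_univ, exists_true_left]
    constructor
    · rintro ⟨⟨i', hc⟩, hc'⟩
      by_cases h : i' = i
      · exact h ▸ hc
      · exact absurd hc' (Set.disjoint_left.1 (hdisj h) (hS i' hc))
    · exact fun hc => ⟨⟨i, hc⟩, hS i hc⟩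
  have hempty {S : Fin s → Set G.Cake} (hS : ∀ i, S i ⊆ (C i).cake) {i : Fin s} (h : S i = ∅) :
      Disjoint (C i).cake (⋃ i ∈ Finset.univ, S i) := by
    rw [Set.disjoint_iff_inter_eq_empty, inter_comm, hinter hS, h]
  have hsub {S : Fin s → Set G.Cake} {i : Fin s} (h : S i = (C i).cake) :
      (C i).cake ⊆ ⋃ i ∈ Finset.univ, S i :=
    h ▸ subset_biUnion_of_mem (u := S) (Finset.mem_univ i)
  have hwhole' (i : Fin s) (h1 : i ≠ j) (h2 : i ≠ k) :
      (C i).Whole (⋃ i ∈ Finset.univ, A i) (⋃ i ∈ Finset.univ, B i) := by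
    rcases hwhole i h1 h2 with ⟨h, h'⟩ | ⟨h, h'⟩
    · exact .inl ⟨hsub h, hempty hB h'⟩
    · exact .inr ⟨hsub h', hempty hA h⟩
  refine ⟨⋃ i ∈ Finset.univ, A i, ⋃ i ∈ Finset.univ, B i, ⟨?_, ?_, ?_, ?_⟩, ?_, ?_, ?_⟩
  · exact .biUnion fun i _ => (hAB i).left
  · exact .biUnion fun i _ => (hAB i).right
  · rw [← iUnion_cake, ← C.surjective.iUnion_comp]
    simp only [Finset.mem_univ, iUnion_true, ← iUnion_union_distrib, (hAB _).union]
  · refine (Set.finite_iUnion fun i => (hAB i).inter).subset ?_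
    intro c hc
    obtain ⟨i, -, hi⟩ := mem_iUnion₂.1 hc.1
    have : c ∈ (⋃ i ∈ Finset.univ, B i) ∩ (C i).cake := ⟨hc.2, hA i hi⟩
    rw [hinter hB] at this
    exact mem_iUnion.2 ⟨i, hi, this⟩
  · intro μ _ _
    have hae (i : Fin s) : A i =ᵐ[μ] T i (p - i) (q - i) :=
      measure_symmDiff_eq_zero_iff.1 ((hAB i).symmDiff.measure_zero μ)
    have hnull (i : Fin s) : NullMeasurableSet (A i) μ :=
      ((hT i).nullMeasurableSet μ _ _).congr (hae i).symm
    refine ⟨.biUnion (Finset.countable_toSet _) fun i _ => hnull i, ?_⟩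
    rw [measureReal_biUnion_finset₀ (fun i _ i' _ h =>
      ((hdisj h).mono (hA i) (hA i')).aedisjoint) fun i _ => hnull i]
    exact Finset.sum_congr rfl fun i _ => measureReal_congr (hae i)
  · calc numPieces (⋃ i ∈ Finset.univ, A i) + numPieces (⋃ i ∈ Finset.univ, B i)
        ≤ ∑ i, pieceCount (A i) + ∑ i, pieceCount (B i) :=
          add_le_add (pieceCount_biUnion_le _ _) (pieceCount_biUnion_le _ _)
      _ = ∑ i, (pieceCount (A i) + pieceCount (B i)) := Finset.sum_add_distrib.symm
      _ ≤ ∑ i : Fin s, (((1 + (if i = j then r + 2 else 0) + (if i = k then r + 2 else 0) : ℕ)) :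
            ℕ∞) := by
          refine Finset.sum_le_sum fun i _ => ?_
          by_cases h1 : i = j <;> by_cases h2 : i = k
          · rw [if_pos h1, if_pos h2]
            refine (add_le_add (hjk' i h1 h2).1 (hjk' i h1 h2).2).trans ?_
            norm_cast
            omega
          · rw [if_pos h1, if_neg h2]
            refine (add_le_add (hj' i h1 h2).1 (hj' i h1 h2).2).trans ?_
            norm_cast
            omega
          · rw [if_neg h1, if_pos h2]
            refine (add_le_add (hk' i h1 h2).1 (hk' i h1 h2).2).trans ?_
            norm_cast
          · rw [if_neg h1, if_neg h2]
            have := (hT i).pieceCount_cake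
            rcases hwhole i h1 h2 with ⟨h, h'⟩ | ⟨h, h'⟩ <;>
              simpa [h, h', pieceCount_empty] using this
      _ = s + 2 * r + 4 := by
          rw [← Nat.cast_sum, Finset.sum_add_distrib, Finset.sum_add_distrib]
          simp only [Finset.sum_const, Finset.card_univ, Fintype.card_fin, smul_eq_mul, mul_one,
            Finset.sum_ite_eq', Finset.mem_univ, if_true]
          norm_cast
          omega
  · by_cases h : j = k
    · subst h
      refine .inl ⟨C j, fun K hK => ?_, ?_⟩
      · obtain ⟨i, rfl⟩ := C.surjective K
        have : i ≠ j := fun h => hK (by rw [h])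
        exact hwhole' i this this
      · rw [hinter hA, hinter hB]
        exact hjk' j rfl rfl
    · refine .inr ⟨C j, C k, C.injective.ne h, fun K hK hK' => ?_, ?_⟩
      · obtain ⟨i, rfl⟩ := C.surjective K
        exact hwhole' i (fun h => hK (by rw [h])) (fun h => hK' (by rw [h]))
      · rw [inter_union_distrib_left, inter_union_distrib_left, hinter hA, hinter hA,
          hinter hB, hinter hB]
        have h1 := hj' j rfl h
        have h2 := hk' k (Ne.symm h) rfl
        constructor
        · refine (pieceCount_union_le _ _).trans ((add_le_add h1.1 h2.1).trans_eq ?_)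
          norm_cast
        · refine (pieceCount_union_le _ _).trans ((add_le_add h1.2 h2.2).trans_eq ?_)
          norm_cast
          omega

theorem IsDivision.isWeightedConsensus {α β : Set G.Cake} (h : IsDivision α β)
    {vA vB : Measure G.Cake} [IsProbabilityMeasure vA] [NullSingletonClass vA]
    [IsProbabilityMeasure vB] [NullSingletonClass vB] (hA : NullMeasurableSet α vA)
    (hB : NullMeasurableSet α vB) {t : ℝ} (htA : vA.real α = t) (htB : vB.real α = t) :
    IsWeightedConsensus vA vB t α β := by
  have key (μ : Measure G.Cake) [IsProbabilityMeasure μ] [NullSingletonClass μ]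
      (hμ : NullMeasurableSet α μ) : μ.real β = 1 - μ.real α := by
    have := measureReal_union₀' hμ (show AEDisjoint μ α β from h.inter.measure_zero μ)
    rw [h.union, probReal_univ] at this
    linarith
  exact ⟨h, htA, htB, by rw [key vA hA, htA], by rw [key vB hB, htB]⟩

theorem IsWeightedConsensus.symm {α β : Set G.Cake} {vA vB : Measure G.Cake} {t : ℝ}
    (h : IsWeightedConsensus vA vB (1 - t) α β) : IsWeightedConsensus vA vB t β α :=
  ⟨h.division.symm, by simpa using h.rightA, by simpa using h.rightB, h.leftA, h.leftB⟩

/-- The measure swept between two times, as a difference of values of a distribution function. -/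
theorem exists_distribution {s r : ℕ} (C : Fin s ≃ G.Component)
    {T : Fin s → ℝ → ℝ → Set G.Cake} (hT : ∀ i, IsSweep (C i) r (T i)) (μ : Measure G.Cake)
    [IsProbabilityMeasure μ] [NullSingletonClass μ] :
    ∃ F : ℝ → ℝ, Continuous F ∧ Monotone F ∧ F s - F 0 = 1 ∧
      ∀ p q, p ≤ q → ∑ i : Fin s, μ.real (T i (p - i) (q - i)) = F q - F p := by
  choose φ hφ hφ' using fun i => (hT i).exists_continuous_measure μ
  have hF (p q : ℝ) (hpq : p ≤ q) : ∑ i : Fin s, μ.real (T i (p - i) (q - i)) =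
      ∑ i : Fin s, φ i (q - i) - ∑ i : Fin s, φ i (p - i) := by
    rw [← Finset.sum_sub_distrib]
    exact Finset.sum_congr rfl fun i _ => hφ' i _ _ (by linarith)
  refine ⟨fun x => ∑ i : Fin s, φ i (x - i), by fun_prop, fun p q hpq => ?_, ?_, hF⟩
  · rw [← sub_nonneg, ← hF p q hpq]
    exact Finset.sum_nonneg fun _ _ => measureReal_nonneg
  · rw [← hF 0 s (Nat.cast_nonneg _), ← probReal_univ (μ := μ), ← iUnion_cake,
      ← C.surjective.iUnion_comp, measureReal_def]
    have hfull (i : Fin s) : T i (0 - i) (s - i) = (C i).cake := by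
      refine (hT i).full (by simp) ?_
      have : ((i : ℕ) : ℝ) + 1 ≤ s := by exact_mod_cast i.2
      linarith
    have hunion : ⋃ i, (C i).cake = ⋃ i ∈ Finset.univ, T i (0 - i) (s - i) := by
      simp only [hfull, Finset.mem_univ, iUnion_true]
    rw [hunion, ← measureReal_def, measureReal_biUnion_finset₀]
    · intro i _ i' _ h
      change AEDisjoint μ (T i (0 - i) (s - i)) (T i' (0 - i') (s - i'))
      rw [hfull, hfull]
      exact (Component.disjoint_cake (C.injective.ne h)).aedisjoint
    · exact fun i _ => (hT i).nullMeasurableSet μ _ _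

end Division

end CakeGraph

theorem theorem7p1 {V E : Type*} [Finite V] [Finite E] (G : CakeGraph V E)
    (s r : ℕ) (hs : Nat.card G.Component = s) (hr : G.maxRadius = (r : ℕ∞))
    (vA vB : Measure G.Cake) [IsProbabilityMeasure vA] [NullSingletonClass vA]
    [IsProbabilityMeasure vB] [NullSingletonClass vB]
    (t : ℝ) (ht0 : 0 ≤ t) (ht1 : t ≤ 1) :
    ∃ α β : Set G.Cake,
      CakeGraph.IsWeightedConsensus vA vB t α β ∧
      CakeGraph.numPieces α + CakeGraph.numPieces β ≤ s + 2 * r + 4 ∧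
      ((∃ C : G.Component,
          (∀ K : G.Component, K ≠ C → CakeGraph.Component.Whole K α β) ∧
          CakeGraph.numPieces (α ∩ CakeGraph.Component.cake C) ≤ r + 2 ∧
          CakeGraph.numPieces (β ∩ CakeGraph.Component.cake C) ≤ r + 2) ∨
        (∃ C D : G.Component, C ≠ D ∧
          (∀ K : G.Component, K ≠ C → K ≠ D → CakeGraph.Component.Whole K α β) ∧
          CakeGraph.numPieces
            (α ∩ (CakeGraph.Component.cake C ∪ CakeGraph.Component.cake D)) ≤ r + 3 ∧
          CakeGraph.numPieces
            (β ∩ (CakeGraph.Component.cake C ∪ CakeGraph.Component.cake D)) ≤ r + 3)) := by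
  obtain ⟨⟨e, x⟩, -⟩ := (Quotient.exists_rep (s := G.gluing)
    (nonempty_of_isProbabilityMeasure vA).some)
  have : Nonempty E := ⟨e⟩
  have hs0 : 0 < s := by
    have : Nonempty G.Component := ⟨G.toSimpleGraph.connectedComponentMk (G.left e)⟩
    rw [← hs]
    exact Nat.card_pos
  let C : Fin s ≃ G.Component := (Finite.equivFinOfCardEq hs).symm
  have hr' (K : G.Component) : K.toSimpleGraph.radius ≤ r :=
    (le_iSup (fun K : G.Component => K.toSimpleGraph.radius) K).trans hr.le
  choose T hT using fun i => CakeGraph.exists_isSweep (C i) (hr' (C i))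
  obtain ⟨F, hF, hFm, hF1, hF'⟩ := CakeGraph.exists_distribution C hT vA
  obtain ⟨H, hH, hHm, hH1, hH'⟩ := CakeGraph.exists_distribution C hT vB
  obtain ⟨p, q, hp, hpq, hq, h⟩ :=
    CakeGraph.exists_common_interval (Nat.cast_nonneg s) hF hH hFm hHm hF1 hH1 ht0 ht1
  obtain ⟨α, β, hdiv, hμ, hnum, hfew⟩ := CakeGraph.exists_division C hT hp hpq hq hs0
  obtain ⟨hA, hA'⟩ := hμ vA
  obtain ⟨hB, hB'⟩ := hμ vB
  rw [hF' p q hpq] at hA'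
  rw [hH' p q hpq] at hB'
  rcases h with ⟨h1, h2⟩ | ⟨h1, h2⟩
  · exact ⟨α, β, hdiv.isWeightedConsensus hA hB (hA'.trans h1) (hB'.trans h2), hnum, hfew⟩
  · exact ⟨β, α, (hdiv.isWeightedConsensus hA hB (hA'.trans h1) (hB'.trans h2)).symm,
      by rwa [add_comm], hfew.symm⟩
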